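/- **Setting.** We work in step-indexed higher-order separation logic (the Iris 2 model, extended with linear resources and resource steps). Target and source are arbitrary languages with a primitive reduction relation $e,\sigma\to e',\sigma',f$, where $f$ is an optional forked-off thread, and $e,\sigma\to e',\sigma'$ means that nothing is forked. The source language has bounded non-determinism: every source configuration (thread pool and state) has finitely many successors. Assertions are the uniform predicates of step-index $n$, affine resource $a$ and linear resource $b$. Resources have four components: invariants, the physical target state, a source execution, and arbitrary user ghost state (any CMRA with a unit). The invariants range over all assertions, through an arbitrary solution $X\cong \mathrm{UPred}(\mathrm{Res}(X))$ of the recursive domain equation. The source component is $(view,K,\mathcal L,I)$: a master or snapshot view, a finite set $K$ of controlled source threads, and an execution $\mathcal L$ of the source program together with the list $I$ of threads that took its steps. Two such elements compose only if the control sets are disjoint, at most one is a master, no snapshot is longer than a master, and one execution extends the other without further steps of the threads that the shorter one controls. Only snapshots take resource steps: first, steps of threads outside $K$ may be speculated, then the threads in $K$ perform a *round*. In a round at least one step is taken, every thread in $K$ steps at most once, and every thread in $K$ that can step does. Threads forked in the round become controlled. (There are no separate delay steps.) The triple $\{P\}\,e\,\{Q\}$ is $\mathsf{aff}\,\Box(P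 \mathrel{-\!\!*} \mathsf{wp}_\top\,e\,\{Q\})$. Here $\mathsf{wp}$ is the weakest precondition in which each target step has to be accompanied by a resource step of the linear resource, and forked-off threads must end in a state where their linear resource cannot step. We write $n\models\{P\}\,e\,\{Q\}$ if the triple holds at step-index $n$. For a source execution $H$ with current configuration $(T,\Sigma)$, $\mathsf{source}_H(i,E)$ is exact linear ownership of the snapshot of $H$ with control set $\{i\}$, where $T[i]=E$. Let $\mathcal B_n(e,\sigma,H,i,E)$ say: there is an assertion $P_n$ such that $$n\models\{\mathsf{source}_H(i,E) * P_n\}\;e\;\{Q\},$$ and the precondition holds at $n$ for some resources $(r,s)$ that satisfy the world at step-index $n$ (full mask) with target state $\sigma$, where the source component of $s$ is the snapshot of $H$ that controls all threads of $T$. **Lemma.** Fix a postcondition $Q$ (an assertion depending on the return value). 1. Let $H$ be a source execution whose current configuration is $([E],\Sigma)$. Suppose $e,\sigma\to e',\sigma'$ and, for all $n$, $\mathcal B_n(e,\sigma,H,0,E)$. Then there are $E',\Sigma'$ and an optional forked thread $f$ with $E,\Sigma\to E',\Sigma',f$ such that, for all $n$, $\mathcal B_n(e',\sigma',H',0,E')$.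 Here $H'$ extends $H$ by this step of thread $0$ (its current thread pool is $[E']$, followed by $f$ if there is one). 2. More generally, let $H$ be any source execution with current configuration $(T,\Sigma)$, $i$ a thread and $E$ an expression. Suppose $e,\sigma\to e',\sigma'$ and, for all $n$, $\mathcal B_n(e,\sigma,H,i,E)$. Then there are a source execution $H'$, which extends $H$ by one round of all threads of $T$, and an expression $E'$ such that, for all $n$, $\mathcal B_n(e',\sigma',H',i,E')$. If thread $i$ steps in this round (in particular, whenever it can step in $(T,\Sigma)$), then $E$ reduces to $E'$ in one primitive step (from some source state to some source state); otherwise $E'=E$. 3. Iterating: if $e_k,\sigma_k\to e_{k+1},\sigma_{k+1}$ for all $k\in\mathbb N$ and, for all $n$, $\mathcal B_n(e_0,\sigma_0,H,i,E)$, then the current configuration of $H$ has a diverging (infinite) source execution. -/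

import Mathlib

set_option linter.unusedVariables false

universe u v w x

namespace FairRef

/-! ## Languages and their thread-pool semantics -/

/-- A language: expressions, values, states and a primitive reduction relation
`prim e σ e' σ' f`, where `f = some e_f` when a new thread `e_f` is forked off. -/
structure Lang where
  Expr : Type u
  Val : Type u
  State : Type u
  ofVal : Val → Expr
  toVal : Expr → Option Val
  prim : Expr → State → Expr → State → Option Expr → Prop
  ofVal_of_toVal : ∀ e v, toVal e = some v → ofVal v = e
  toVal_ofVal : ∀ v, toVal (ofVal v) = some v
  val_stuck : ∀ e σ e' σ' f, prim e σ e' σ' f → toVal e = none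

namespace Lang

variable (L : Lang.{u})

/-- The expression `e` is reducible in state `σ`. -/
def Red (e : L.Expr) (σ : L.State) : Prop := ∃ e' σ' f, L.prim e σ e' σ' f

/-- Configurations: a thread pool and a state. -/
abbrev Config : Type u := List L.Expr × L.State

/-- Thread number `i` of the pool takes a step. -/
def CStep (i : ℕ) (C C' : L.Config) : Prop :=
  ∃ (T T' : List L.Expr) (e e' : L.Expr) (σ σ' : L.State) (f : Option L.Expr),
    T.length = i ∧ L.prim e σ e' σ' f ∧
      C = (T ++ [e] ++ T', σ) ∧ C' = (T ++ [e'] ++ T' ++ f.toList, σ')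

/-- Thread index `i` is enabled in `C`. -/
def Enabled (i : ℕ) (C : L.Config) : Prop := ∃ C', L.CStep i C C'

/-- Every configuration has only finitely many successors. -/
def BoundedNondet : Prop := ∀ C : L.Config, {C' | ∃ i, L.CStep i C C'}.Finite

/-- `F` is a diverging execution of `C`; `(F n).2` is the thread that takes the `n`-th step. -/
def Diverges (C : L.Config) (F : ℕ → L.Config × ℕ) : Prop :=
  (F 0).1 = C ∧ ∀ n, L.CStep (F n).2 (F n).1 (F (n + 1)).1

/-- `Run C js cs C'`: starting in `C`, the threads `js` take one step each, in this order; the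
configurations reached are `cs`, and the last one is `C'` (which is `C` when `js` is empty). -/
inductive Run : L.Config → List ℕ → List L.Config → L.Config → Prop
  | nil (C : L.Config) : Run C [] [] C
  | cons {C C₁ C' : L.Config} {j : ℕ} {js : List ℕ} {cs : List L.Config} :
      L.CStep j C C₁ → Run C₁ js cs C' → Run C (j :: js) (C₁ :: cs) C'

/-- A round of the threads in `K`: at least one step is taken, all steps are taken by threads
in `K`, every thread steps at most once, and every thread in `K` which can step does so. -/
def Round (K : Finset ℕ) (C : L.Config) (js : List ℕ) (cs : List L.Config) (C' : L.Config) :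
    Prop :=
  L.Run C js cs C' ∧ js ≠ [] ∧ js.Nodup ∧ (∀ j ∈ js, j ∈ K) ∧ ∀ k ∈ K, L.Enabled k C → k ∈ js

end Lang

/-! ## Ordered families of equivalences and resource algebras -/

/-- Step-indexed equivalence. -/
class HasDist (α : Type u) where
  dist : ℕ → α → α → Prop

open HasDist

/-- Complete ordered families of equivalences. -/
class COFE (α : Type u) extends HasDist α where
  dist_equiv : ∀ n, Equivalence (dist n)
  dist_mono : ∀ n m (a b : α), m ≤ n → dist n a b → dist m a b
  eq_iff : ∀ a b : α, a = b ↔ ∀ n, dist n a b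
  lim : (c : ℕ → α) → (∀ n m, n ≤ m → dist n (c m) (c n)) → α
  lim_dist : ∀ c hc n, dist n (lim c hc) (c n)

/-- The operations of a step-indexed resource algebra with a unit (so that the core is total).
`step n` is the relation of taking a resource step. -/
class CMRAOps (M : Type u) extends HasDist M where
  valid : ℕ → M → Prop
  core : M → M
  op : M → M → M
  unit : M
  step : ℕ → M → M → Prop

open CMRAOps

/-- The extension order. -/
def Incl {M : Type u} [CMRAOps M] (a b : M) : Prop := ∃ c, b = op a c

/-- CMRAs with a unit: all operations and relations are non-expansive, and the algebraic laws
hold. -/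
class UCMRA (M : Type u) extends COFE M, CMRAOps M where
  valid_ne : ∀ n (a b : M), dist n a b → valid n a → valid n b
  valid_mono : ∀ n m (a : M), m ≤ n → valid n a → valid m a
  step_ne : ∀ n (a a' b b' : M), dist n a a' → dist n b b' → step n a b → step n a' b'
  step_mono : ∀ n m (a b : M), m ≤ n → step n a b → step m a b
  op_ne : ∀ n (a a' b b' : M), dist n a a' → dist n b b' → dist n (op a b) (op a' b')
  core_ne : ∀ n (a b : M), dist n a b → dist n (core a) (core b)
  op_assoc : ∀ a b c : M, op (op a b) c = op a (op b c)
  op_comm : ∀ a b : M, op a b = op b a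
  core_id : ∀ a : M, op (core a) a = a
  core_idem : ∀ a : M, core (core a) = core a
  core_mono : ∀ a b : M, Incl a b → Incl (core a) (core b)
  core_distrib : ∀ n (a b : M), valid n (op a b) →
    dist n (core (op (core a) (core b))) (op (core a) (core b))
  valid_op : ∀ n (a b : M), valid n (op a b) → valid n a
  extend : ∀ n (a b₁ b₂ : M), valid n a → dist n a (op b₁ b₂) →
    ∃ c₁ c₂, a = op c₁ c₂ ∧ dist n c₁ b₁ ∧ dist n c₂ b₂
  unit_valid : ∀ n, valid n (unit : M)
  unit_op : ∀ a : M, op unit a = a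
  unit_discrete : ∀ a : M, dist 0 unit a → unit = a
  core_unit : core (unit : M) = unit

/-! ## Later, agreement, finite maps, exclusive states -/

/-- The type-level later. -/
structure Later (α : Type u) where
  next ::
  val : α

instance Later.instCOFE {α : Type u} [COFE α] : COFE (Later α) where
  dist n a b := n = 0 ∨ dist (n - 1) a.val b.val
  dist_equiv n :=
    { refl := fun a => Or.inr ((COFE.dist_equiv (n - 1)).refl a.val)
      symm := fun h => h.imp id (fun h => (COFE.dist_equiv (n - 1)).symm h)
      trans := fun h h' => by
        rcases h with h | h
        · exact Or.inl h
        · rcases h' with h' | h'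
          · exact Or.inl h'
          · exact Or.inr ((COFE.dist_equiv (n - 1)).trans h h') }
  dist_mono n m a b hm h := by
    rcases h with h | h
    · exact Or.inl (by omega)
    · exact Or.inr (COFE.dist_mono _ _ _ _ (by omega) h)
  eq_iff a b := by
    constructor
    · rintro rfl n
      exact Or.inr ((COFE.dist_equiv (n - 1)).refl a.val)
    · intro h
      cases a with
      | next a =>
        cases b with
        | next b =>
          have hab : a = b := (COFE.eq_iff a b).2 (fun n => by
            rcases h (n + 1) with h | h
            · omega
            · simpa using h)
          rw [hab]
  lim c hc := ⟨COFE.lim (fun n => (c (n + 1)).val) (fun n m hnm => by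
    rcases hc (n + 1) (m + 1) (by omega) with h | h
    · omega
    · simpa using h)⟩
  lim_dist c hc n := by
    rcases n with _ | n
    · exact Or.inl rfl
    · exact Or.inr (COFE.lim_dist (fun n => (c (n + 1)).val) _ n)

/-- Representatives of elements of the agreement construction: a sequence of elements which has
to converge only on the down-closed set `V` of step-indices. -/
structure AgreeRaw (α : Type u) where
  c : ℕ → α
  V : Set ℕ
  down : ∀ n m, m ≤ n → n ∈ V → m ∈ V

namespace AgreeRaw

variable {α : Type u} [COFE α]

def rdist (n : ℕ) (a b : AgreeRaw α) : Prop :=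
  (∀ m ≤ n, m ∈ a.V ↔ m ∈ b.V) ∧ ∀ m ≤ n, m ∈ a.V → dist m (a.c m) (b.c m)

theorem rdist_equiv (n : ℕ) : Equivalence (rdist (α := α) n) where
  refl a := ⟨fun _ _ => Iff.rfl, fun m _ _ => (COFE.dist_equiv m).refl _⟩
  symm h := ⟨fun m hm => (h.1 m hm).symm,
    fun m hm hv => (COFE.dist_equiv m).symm (h.2 m hm ((h.1 m hm).2 hv))⟩
  trans h h' := ⟨fun m hm => (h.1 m hm).trans (h'.1 m hm),
    fun m hm hv => (COFE.dist_equiv m).trans (h.2 m hm hv) (h'.2 m hm ((h.1 m hm).1 hv))⟩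

theorem rdist_mono {n m : ℕ} {a b : AgreeRaw α} (hm : m ≤ n) (h : rdist n a b) : rdist m a b :=
  ⟨fun k hk => h.1 k (hk.trans hm), fun k hk => h.2 k (hk.trans hm)⟩

instance setoid (α : Type u) [COFE α] : Setoid (AgreeRaw α) where
  r a b := a.V = b.V ∧ ∀ n ∈ a.V, dist n (a.c n) (b.c n)
  iseqv :=
    { refl := fun a => ⟨rfl, fun n _ => (COFE.dist_equiv n).refl _⟩
      symm := fun h => ⟨h.1.symm, fun n hn => (COFE.dist_equiv n).symm (h.2 n (h.1 ▸ hn))⟩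
      trans := fun h h' => ⟨h.1.trans h'.1,
        fun n hn => (COFE.dist_equiv n).trans (h.2 n hn) (h'.2 n (h.1 ▸ hn))⟩ }

theorem rdist_of_equiv {a b : AgreeRaw α} (h : a ≈ b) (n : ℕ) : rdist n a b :=
  ⟨fun m _ => by rw [h.1], fun m _ hv => h.2 m hv⟩

def rvalid (n : ℕ) (a : AgreeRaw α) : Prop := n ∈ a.V ∧ ∀ m ≤ n, dist m (a.c n) (a.c m)

def rop (a b : AgreeRaw α) : AgreeRaw α where
  c := a.c
  V := {n | n ∈ a.V ∧ n ∈ b.V ∧ rdist n a b}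
  down n m hm h := ⟨a.down n m hm h.1, b.down n m hm h.2.1, rdist_mono hm h.2.2⟩

theorem rvalid_congr {n : ℕ} {a b : AgreeRaw α} (h : a ≈ b) (ha : rvalid n a) : rvalid n b := by
  refine ⟨h.1 ▸ ha.1, fun m hm => ?_⟩
  have e := COFE.dist_equiv (α := α) m
  exact e.trans (e.symm (COFE.dist_mono _ _ _ _ hm (h.2 n ha.1)))
    (e.trans (ha.2 m hm) (h.2 m (a.down n m hm ha.1)))

end AgreeRaw

/-- The agreement construction. -/
def Agree (α : Type u) [COFE α] : Type u := Quotient (AgreeRaw.setoid α)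

namespace Agree

variable {α : Type u} [COFE α]

/-- The injection of `α` into `Agree α`. -/
def inj (a : α) : Agree α := Quotient.mk _ ⟨fun _ => a, Set.univ, fun _ _ _ _ => trivial⟩

instance : HasDist (Agree α) where
  dist n := Quotient.lift₂ (AgreeRaw.rdist n) (by
    intro a b a' b' ha hb
    have e := AgreeRaw.rdist_equiv (α := α) n
    exact propext
      ⟨fun h => e.trans (e.symm (AgreeRaw.rdist_of_equiv ha n))
        (e.trans h (AgreeRaw.rdist_of_equiv hb n)),
       fun h => e.trans (AgreeRaw.rdist_of_equiv ha n)
        (e.trans h (e.symm (AgreeRaw.rdist_of_equiv hb n)))⟩)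

def valid (n : ℕ) : Agree α → Prop :=
  Quotient.lift (AgreeRaw.rvalid n) (fun _ _ h => propext
    ⟨AgreeRaw.rvalid_congr h, AgreeRaw.rvalid_congr (Setoid.symm h)⟩)

def op : Agree α → Agree α → Agree α :=
  Quotient.map₂ AgreeRaw.rop (by
    intro a a' ha b b' hb
    refine ⟨?_, fun n hn => ha.2 n hn.1⟩
    ext n
    have e := AgreeRaw.rdist_equiv (α := α) n
    have h : AgreeRaw.rdist n a b ↔ AgreeRaw.rdist n a' b' :=
      ⟨fun h => e.trans (e.symm (AgreeRaw.rdist_of_equiv ha n))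
        (e.trans h (AgreeRaw.rdist_of_equiv hb n)),
       fun h => e.trans (AgreeRaw.rdist_of_equiv ha n)
        (e.trans h (e.symm (AgreeRaw.rdist_of_equiv hb n)))⟩
    change (n ∈ a.V ∧ n ∈ b.V ∧ _) ↔ (n ∈ a'.V ∧ n ∈ b'.V ∧ _)
    rw [ha.1, hb.1, h])

end Agree

/-- Finite partial functions on the natural numbers. -/
structure FMap (A : Type u) where
  get : ℕ → Option A
  fin : {k | get k ≠ none}.Finite

namespace FMap

variable {A : Type u}

/-- The domain. -/
def dom (f : FMap A) : Set ℕ := {k | f.get k ≠ none}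

def empty : FMap A := ⟨fun _ => none, by simp⟩

/-- Pointwise composition; `none` acts as a unit. -/
def mergeWith (g : A → A → A) (f₁ f₂ : FMap A) : FMap A where
  get k := Option.merge g (f₁.get k) (f₂.get k)
  fin := (f₁.fin.union f₂.fin).subset (by
    intro k hk
    by_contra h
    simp only [Set.mem_union, Set.mem_ofPred_eq, not_or, not_not] at h
    exact hk (by simp [h.1, h.2]))

instance [HasDist A] : HasDist (FMap A) where
  dist n f₁ f₂ := ∀ k, Option.Rel (dist n) (f₁.get k) (f₂.get k)

/-- The composition of all elements in the range of a finite map. -/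
noncomputable def prod (g : A → A → A) (one : A) (f : FMap A) : A :=
  (f.fin.toFinset.sort (· ≤ ·)).foldr (fun k acc => g ((f.get k).getD one) acc) one

end FMap

/-- The exclusive construction on (discrete) states, with a unit added. -/
inductive PhysRes (S : Type u) : Type u
  | unit
  | ex (σ : S)
  | bot

/-- Composition: every composition of two non-unit elements is invalid. -/
def PhysRes.op {S : Type u} : PhysRes S → PhysRes S → PhysRes S
  | .unit, b => b
  | a, .unit => a
  | _, _ => .bot

def PhysRes.core {S : Type u} : PhysRes S → PhysRes S
  | .bot => .bot
  | _ => .unit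

/-! ## The resource algebra of source executions -/

inductive View
  | master
  | snapshot

def View.max : View → View → View
  | .snapshot, .snapshot => .snapshot
  | _, _ => .master

section Refinement

variable (Λ : Lang.{v})

/-- `cfgs` is an execution in which the successive steps are taken by the threads `idxs`, and
`tids` are threads of its last configuration (or everything is empty). -/
def RefValid (tids : Finset ℕ) (cfgs : List Λ.Config) (idxs : List ℕ) : Prop :=
  (cfgs = [] ∧ idxs = [] ∧ tids = ∅) ∨
    ∃ C₀ cs C, cfgs = C₀ :: cs ∧ Λ.Run C₀ idxs cs C ∧ ∀ i ∈ tids, i < C.1.length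

/-- A view, a set of controlled threads, and (a prefix of) an execution of the source program
together with the indices of the threads that took its steps. -/
structure RefElem where
  view : View
  tids : Finset ℕ
  cfgs : List Λ.Config
  idxs : List ℕ
  valid : RefValid Λ tids cfgs idxs

/-- All invalid elements are identified with `bot`. -/
inductive RefRes : Type v
  | el (a : RefElem Λ)
  | bot

variable {Λ}

/-- The execution of `b` extends that of `a` without further steps of threads controlled
by `a`. -/
def RefElem.Ext (a b : RefElem Λ) : Prop :=
  ∃ cs js, b.cfgs = a.cfgs ++ cs ∧ b.idxs = a.idxs ++ js ∧ ∀ i ∈ a.tids, i ∉ js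

/-- The composition of `a` and `b` is defined. -/
def RefElem.Compat (a b : RefElem Λ) : Prop :=
  Disjoint a.tids b.tids ∧
    match a.view, b.view with
    | .master, .master => False
    | .snapshot, .snapshot => a.Ext b ∨ b.Ext a
    | .snapshot, .master => a.Ext b
    | .master, .snapshot => b.Ext a

/-- The longer one of two lists. -/
def longer {A : Type u} (l₁ l₂ : List A) : List A := if l₁.length ≤ l₂.length then l₂ else l₁

open Classical in
noncomputable def RefRes.op : RefRes Λ → RefRes Λ → RefRes Λ
  | .el a, .el b =>
    if h : a.Compat b ∧
        RefValid Λ (a.tids ∪ b.tids) (longer a.cfgs b.cfgs) (longer a.idxs b.idxs) then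
      .el ⟨a.view.max b.view, a.tids ∪ b.tids, longer a.cfgs b.cfgs, longer a.idxs b.idxs, h.2⟩
    else .bot
  | _, _ => .bot

/-- The unit: a snapshot of the empty execution. -/
def RefRes.unit : RefRes Λ := .el ⟨.snapshot, ∅, [], [], Or.inl ⟨rfl, rfl, rfl⟩⟩

/-- The core: a snapshot of the same execution which controls no thread. -/
def RefRes.core : RefRes Λ → RefRes Λ
  | .el a => .el ⟨.snapshot, ∅, a.cfgs, a.idxs, by
      rcases a.valid with h | ⟨C₀, cs, C, h₁, h₂, _⟩
      · exact Or.inl ⟨h.1, h.2.1, rfl⟩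
      · exact Or.inr ⟨C₀, cs, C, h₁, h₂, by simp⟩⟩
  | .bot => .bot

/-- Resource steps are source steps, and only snapshots take them. First, steps `spec` of threads
which are not controlled by the snapshot are speculated; then the controlled threads perform a
round of steps. The threads forked off in this round become controlled. -/
def RefRes.step (x y : RefRes Λ) : Prop :=
  ∃ (a b : RefElem Λ) (C₀ C₁ C₂ : Λ.Config) (spec own : List ℕ) (cs₁ cs₂ : List Λ.Config),
    x = .el a ∧ y = .el b ∧ a.view = .snapshot ∧ b.view = .snapshot ∧
    a.cfgs.getLast? = some C₀ ∧
    Λ.Run C₀ spec cs₁ C₁ ∧ (∀ j ∈ spec, j ∉ a.tids) ∧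
    Λ.Round a.tids C₁ own cs₂ C₂ ∧
    b.cfgs = a.cfgs ++ cs₁ ++ cs₂ ∧ b.idxs = a.idxs ++ spec ++ own ∧
    b.tids = a.tids ∪ Finset.Ico C₁.1.length C₂.1.length

end Refinement

/-! ## Global resources -/

/-- Global resources: invariants (whose contents live in `X`), the physical state of the target
program, the source execution, and further ghost state `G` chosen by the user. -/
structure Res (Tgt : Lang.{u}) (Src : Lang.{v}) (G : Type w) (X : Type x) [COFE X] where
  wld : FMap (Agree (Later X))
  phys : PhysRes Tgt.State
  src : RefRes Src
  gst : G

noncomputable instance Res.instOps {Tgt : Lang.{u}} {Src : Lang.{v}} {G : Type w} {X : Type x}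
    [COFE X] [UCMRA G] : CMRAOps (Res Tgt Src G X) where
  dist n a b := dist n a.wld b.wld ∧ a.phys = b.phys ∧ a.src = b.src ∧ dist n a.gst b.gst
  valid n a := (∀ k c, a.wld.get k = some c → c.valid n) ∧ a.phys ≠ .bot ∧ a.src ≠ .bot ∧
    valid n a.gst
  -- every element of the agreement construction is its own core
  core a := ⟨a.wld, a.phys.core, a.src.core, core a.gst⟩
  op a b := ⟨a.wld.mergeWith Agree.op b.wld, a.phys.op b.phys, a.src.op b.src, op a.gst b.gst⟩
  unit := ⟨.empty, .unit, .unit, unit⟩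
  -- the step relation is the full relation on the first two components
  step n a b := a.src.step b.src ∧ step n a.gst b.gst

/-! ## Assertions -/

/-- Uniform predicates: sets of triples of a step-index, an affine and a linear resource. They are
non-expansive, upward closed in the affine resource and downward closed in the step-index. -/
structure UPred (M : Type u) [CMRAOps M] where
  holds : ℕ → M → M → Prop
  ne : ∀ n a a' b b', dist n a a' → dist n b b' → holds n a b → holds n a' b'
  mono : ∀ n m a a' b, holds n a b → Incl a a' → m ≤ n → valid m a' → valid m b → holds m a' b

instance {M : Type u} [CMRAOps M] : HasDist (UPred M) where
  dist n P Q := ∀ a b, ∀ m ≤ n, P.holds m a b ↔ Q.holds m a b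

/-- A solution of the recursive domain equation `X ≅ UPred (Res X)`: an isomorphism of ordered
families of equivalences. -/
structure Model (Tgt : Lang.{u}) (Src : Lang.{v}) (G : Type w) (X : Type x) [COFE X] [UCMRA G]
    where
  iso : UPred (Res Tgt Src G X) ≃ X
  iso_dist : ∀ n P Q, dist n (iso P) (iso Q) ↔ dist n P Q

section Connectives

variable {M : Type u} [CMRAOps M]

/-- `A n a b`: the affine resource `a` and the linear resource `b` satisfy `A` for `n` steps. -/
abbrev Assn (M : Type u) := ℕ → M → M → Prop

/-- Separating conjunction. -/
def sep (P Q : Assn M) : Assn M := fun n a b =>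
  ∃ a₁ a₂ b₁ b₂, dist n a (op a₁ a₂) ∧ dist n b (op b₁ b₂) ∧ P n a₁ b₁ ∧ Q n a₂ b₂

/-- Magic wand. -/
def wand (P Q : Assn M) : Assn M := fun n a b =>
  ∀ m a' b', m ≤ n → valid m (op a a') → valid m (op b b') → P m a' b' → Q m (op a a') (op b b')

/-- The persistence modality. -/
def always (P : Assn M) : Assn M := fun n a b => P n (core a) (core b) ∧ dist n b (core b)

/-- The affine modality. -/
def aff (P : Assn M) : Assn M := fun n a b => P n a b ∧ dist n b unit

/-- Exact ownership of a linear resource. -/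
def ownLin (r : M) : Assn M := fun n _ b => dist n r b

/-- The controlled source threads can no longer take steps. -/
def stopped : Assn M := fun n _ b => ∀ m ≤ n, ∀ b', ¬ step m b b'

end Connectives

section Logic

variable {Tgt : Lang.{u}} {Src : Lang.{v}} {G : Type w} {X : Type x} [COFE X] [UCMRA G]

/-- World satisfaction at step-index `n + 1`, for a given assignment `rs` of resources to the
invariants. -/
def wsatPre (μ : Model Tgt Src G X) (n : ℕ) (E : Set ℕ) (σ : Tgt.State)
    (rs : FMap (Res Tgt Src G X)) (r s : Res Tgt Src G X) : Prop :=
  valid (n + 1) (op r s) ∧ r.phys = .ex σ ∧ rs.dom ⊆ E ∩ r.wld.dom ∧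
    ∀ k ∈ E, ∀ P : UPred (Res Tgt Src G X),
      (∃ c, r.wld.get k = some c ∧ dist (n + 1) c (Agree.inj (Later.next (μ.iso P)))) →
        ∃ t, rs.get k = some t ∧ P.holds n t unit

/-- World satisfaction. -/
def wsat (μ : Model Tgt Src G X) (E : Set ℕ) (σ : Tgt.State) (r s : Res Tgt Src G X) :
    ℕ → Prop
  | 0 => True
  | n + 1 => ∃ rs : FMap (Res Tgt Src G X), wsatPre μ n E σ rs (op r (rs.prod op unit)) s

/-- The weakest precondition, by recursion on the step-index: whenever the target thread takes a
step, the linear resource has to take a step, and forked-off threads have to end up `stopped`. -/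
def wp (μ : Model Tgt Src G X) (E : Set ℕ) (e : Tgt.Expr)
    (Φ : Tgt.Val → Assn (Res Tgt Src G X)) (n : ℕ) (r s : Res Tgt Src G X) : Prop :=
  ∀ m, m < n → ∀ (rf sf : Res Tgt Src G X) (Ef : Set ℕ) (σ : Tgt.State), Disjoint E Ef →
    wsat μ (E ∪ Ef) σ (op r rf) (op s sf) (m + 1) →
    (∀ v, Tgt.toVal e = some v →
      ∃ r', Φ v (m + 1) r' s ∧ wsat μ (E ∪ Ef) σ (op r' rf) (op s sf) (m + 1)) ∧
    (Tgt.toVal e = none → 0 < m → Tgt.Red e σ ∧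
      ∀ e₂ σ₂ f, Tgt.prim e σ e₂ σ₂ f →
        ∃ r₁ r₂ s₁ s₂ : Res Tgt Src G X,
          wsat μ (E ∪ Ef) σ₂ (op (op r₁ r₂) rf) (op (op s₁ s₂) sf) m ∧
          wp μ E e₂ Φ m r₁ s₁ ∧
          ((f = none ∧ dist m s₂ unit) ∨
            ∃ e_f, f = some e_f ∧ wp μ Set.univ e_f (fun _ => stopped) m r₂ s₂) ∧
          step m s (op s₁ s₂))
termination_by n

/-- The Hoare triple (with the full mask) as an assertion. -/
def hoare (μ : Model Tgt Src G X) (P : Assn (Res Tgt Src G X)) (e : Tgt.Expr)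
    (Q : Tgt.Val → Assn (Res Tgt Src G X)) : Assn (Res Tgt Src G X) :=
  aff (always (wand P (wp μ Set.univ e Q)))

/-- The Hoare triple holds at step-index `n`, that is, for all resources that satisfy its
precondition. -/
def HoareAt (μ : Model Tgt Src G X) (n : ℕ) (P : Assn (Res Tgt Src G X)) (e : Tgt.Expr)
    (Q : Tgt.Val → Assn (Res Tgt Src G X)) : Prop :=
  hoare μ P e Q n unit unit

end Logic

/-! ## Source assertions -/

/-- An execution of the source program: the configurations `past` were visited, the current
configuration is `cur`, and the steps were taken by the threads `idxs`. -/
structure SrcExec (Λ : Lang.{v}) where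
  past : List Λ.Config
  cur : Λ.Config
  idxs : List ℕ

namespace SrcExec

variable {Λ : Lang.{v}}

/-- All configurations, the current one last. -/
def cfgs (H : SrcExec Λ) : List Λ.Config := H.past ++ [H.cur]

/-- `H` extended by one step of thread `j` to `C`. -/
def snoc (H : SrcExec Λ) (j : ℕ) (C : Λ.Config) : SrcExec Λ := ⟨H.cfgs, C, H.idxs ++ [j]⟩

/-- `H'` extends `H` by a round `js` of the threads in `K`. -/
def RoundTo (H : SrcExec Λ) (K : Finset ℕ) (js : List ℕ) (H' : SrcExec Λ) : Prop :=
  ∃ cs, Λ.Round K H.cur js cs H'.cur ∧ H'.cfgs = H.cfgs ++ cs ∧ H'.idxs = H.idxs ++ js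

end SrcExec

section Source

variable {Tgt : Lang.{u}} {Src : Lang.{v}} {G : Type w} {X : Type x} [COFE X] [UCMRA G]

/-- `source(i, E)` in the source execution `H`: exact linear ownership of the snapshot of `H`
which controls thread `i`, where `i` is running `E` in the current configuration. -/
def source (H : SrcExec Src) (i : ℕ) (E : Src.Expr) : Assn (Res Tgt Src G X) := fun n a b =>
  ∃ h : RefValid Src {i} H.cfgs H.idxs,
    H.cur.1[i]? = some E ∧
      ownLin ⟨.empty, .unit, .el ⟨.snapshot, {i}, H.cfgs, H.idxs, h⟩, unit⟩ n a b

/-- The linear resource `s` is a snapshot of `H` that controls all threads of the current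
configuration of the source program. -/
def ControlsAll (H : SrcExec Src) (s : Res Tgt Src G X) : Prop :=
  ∃ h : RefValid Src (Finset.range H.cur.1.length) H.cfgs H.idxs,
    s.src = .el ⟨.snapshot, Finset.range H.cur.1.length, H.cfgs, H.idxs, h⟩

/-- For some `P`, the triple `{source(i, E) * P} e {Q}` holds at step-index `n`, and its
precondition is satisfied, for `n` steps, by resources describing the target state `σ` and the
source execution `H`, where `e` is in charge of the whole source program. -/
def SourceTriple (μ : Model Tgt Src G X) (n : ℕ) (e : Tgt.Expr) (σ : Tgt.State)
    (Q : Tgt.Val → UPred (Res Tgt Src G X)) (H : SrcExec Src) (i : ℕ) (E : Src.Expr) : Prop :=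
  ∃ P : UPred (Res Tgt Src G X),
    HoareAt μ n (sep (source H i E) P.holds) e (fun v => (Q v).holds) ∧
    ∃ r s : Res Tgt Src G X, sep (source H i E) P.holds n r s ∧
      wsat μ Set.univ σ r s n ∧ ControlsAll H s

end Source

end FairRef

open FairRef

/-! Fix an index. Applying the triple at `n + 2` to the given resources yields a weakest
precondition for `e`, and the target step then forces a resource step from the linear resource `s`
to some `s₁`, with a weakest precondition for `e'` at `n + 1`. No thread is forked, so no part of
the linear resource is given away. Since `s` controls every source thread, nothing can be
speculated: the resource step is exactly one non-empty round of the whole pool. Threads forked in it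
become controlled, so `s₁` again controls everything (`ControlsAll.exists_roundTo`).

To get a triple for `e'`, the control of thread `i` is split off from `s₁`, and `P` is chosen as
"whatever makes the weakest precondition true together with that part" (`wpFrame`). The triple is
then a tautology, and the rest of `s₁` satisfies `P` (`SourceTriple.of_wp`).

The round found this way depends on `n`. By bounded non-determinism only finitely many rounds exist
(`finite_roundTo`), and source triples are downward closed in the index (`SourceTriple.mono`), so
one round works for all `n`. Iteration concatenates non-empty rounds into an infinite execution.

The algebraic laws serve to make `wpFrame` a uniform predicate and world satisfaction downward
closed. The delicate one is associativity for source executions. -/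

namespace FairRef

open HasDist CMRAOps

/-! ## Laws of the agreement construction -/

namespace Agree

variable {α : Type u} [COFE α]

theorem dist_equiv (n : ℕ) : Equivalence (dist n : Agree α → Agree α → Prop) where
  refl a := by
    induction a using Quotient.inductionOn
    exact (AgreeRaw.rdist_equiv n).refl _
  symm {a b} h := by
    induction a using Quotient.inductionOn
    induction b using Quotient.inductionOn
    exact (AgreeRaw.rdist_equiv n).symm h
  trans {a b c} h h' := by
    induction a using Quotient.inductionOn
    induction b using Quotient.inductionOn
    induction c using Quotient.inductionOn
    exact (AgreeRaw.rdist_equiv n).trans h h'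

theorem dist_mono {n m : ℕ} {a b : Agree α} (hm : m ≤ n) (h : dist n a b) : dist m a b := by
  induction a using Quotient.inductionOn
  induction b using Quotient.inductionOn
  exact AgreeRaw.rdist_mono hm h

theorem valid_ne {n : ℕ} {a b : Agree α} (h : dist n a b) (ha : a.valid n) : b.valid n := by
  induction a using Quotient.inductionOn with | _ a
  induction b using Quotient.inductionOn with | _ b
  obtain ⟨h₁, h₂⟩ : AgreeRaw.rdist n a b := h
  obtain ⟨h₃, h₄⟩ : AgreeRaw.rvalid n a := ha
  refine ⟨(h₁ n le_rfl).1 h₃, fun m hm => ?_⟩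
  have e := COFE.dist_equiv (α := α) m
  exact e.trans (e.symm (COFE.dist_mono _ _ _ _ hm (h₂ n le_rfl h₃)))
    (e.trans (h₄ m hm) (h₂ m hm (a.down _ _ hm h₃)))

theorem valid_mono {n m : ℕ} {a : Agree α} (hm : m ≤ n) (ha : a.valid n) : a.valid m := by
  induction a using Quotient.inductionOn with | _ a
  obtain ⟨h₃, h₄⟩ : AgreeRaw.rvalid n a := ha
  refine ⟨a.down _ _ hm h₃, fun k hk => ?_⟩
  have e := COFE.dist_equiv (α := α) k
  exact e.trans (e.symm (COFE.dist_mono _ _ _ _ hk (h₄ m hm))) (h₄ k (hk.trans hm))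

theorem op_ne {n : ℕ} {a a' b b' : Agree α} (ha : dist n a a') (hb : dist n b b') :
    dist n (a.op b) (a'.op b') := by
  induction a using Quotient.inductionOn with | _ a
  induction b using Quotient.inductionOn with | _ b
  induction a' using Quotient.inductionOn with | _ a'
  induction b' using Quotient.inductionOn with | _ b'
  have h₁ : AgreeRaw.rdist n a a' := ha
  have h₂ : AgreeRaw.rdist n b b' := hb
  refine ⟨fun m hm => ?_, fun m hm hv => h₁.2 m hm hv.1⟩
  have e := AgreeRaw.rdist_equiv (α := α) m
  have k₁ := AgreeRaw.rdist_mono hm h₁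
  have k₂ := AgreeRaw.rdist_mono hm h₂
  have h : AgreeRaw.rdist m a b ↔ AgreeRaw.rdist m a' b' :=
    ⟨fun h => e.trans (e.symm k₁) (e.trans h k₂), fun h => e.trans k₁ (e.trans h (e.symm k₂))⟩
  change (m ∈ a.V ∧ m ∈ b.V ∧ _) ↔ (m ∈ a'.V ∧ m ∈ b'.V ∧ _)
  rw [h₁.1 m hm, h₂.1 m hm, h]

theorem rop_rdist {n : ℕ} {a b : AgreeRaw α} (h : AgreeRaw.rdist n a b) :
    AgreeRaw.rdist n (a.rop b) a :=
  ⟨fun m hm => ⟨fun hv => hv.1,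
      fun hv => ⟨hv, (h.1 m hm).1 hv, AgreeRaw.rdist_mono hm h⟩⟩,
    fun m _ _ => (COFE.dist_equiv m).refl _⟩

theorem op_comm (a b : Agree α) : a.op b = b.op a := by
  induction a using Quotient.inductionOn with | _ a
  induction b using Quotient.inductionOn with | _ b
  refine Quotient.sound ⟨?_, fun n hn => hn.2.2.2 n le_rfl hn.1⟩
  ext n
  have e := AgreeRaw.rdist_equiv (α := α) n
  exact ⟨fun h => ⟨h.2.1, h.1, e.symm h.2.2⟩, fun h => ⟨h.2.1, h.1, e.symm h.2.2⟩⟩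

theorem op_assoc (a b c : Agree α) : (a.op b).op c = a.op (b.op c) := by
  induction a using Quotient.inductionOn with | _ a
  induction b using Quotient.inductionOn with | _ b
  induction c using Quotient.inductionOn with | _ c
  refine Quotient.sound ⟨?_, fun n hn => (COFE.dist_equiv n).refl _⟩
  ext n
  have e := AgreeRaw.rdist_equiv (α := α) n
  constructor
  · rintro ⟨⟨ha, hb, hab⟩, hc, h⟩
    have hac := e.trans (e.symm (rop_rdist hab)) h
    have hbc := e.trans (e.symm hab) hac
    exact ⟨ha, ⟨hb, hc, hbc⟩, e.trans hab (e.symm (rop_rdist hbc))⟩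
  · rintro ⟨ha, ⟨hb, hc, hbc⟩, h⟩
    have hab := e.trans h (rop_rdist hbc)
    exact ⟨⟨ha, hb, hab⟩, hc, e.trans (rop_rdist hab) (e.trans hab hbc)⟩

theorem valid_op {n : ℕ} {a b : Agree α} (h : (a.op b).valid n) : a.valid n := by
  induction a using Quotient.inductionOn with | _ a
  induction b using Quotient.inductionOn with | _ b
  obtain ⟨h₁, h₂⟩ : AgreeRaw.rvalid n (a.rop b) := h
  exact ⟨h₁.1, h₂⟩

/-- Validity at `n` says that the sequence has converged up to `n`, so its `n`-th entry represents
it. This recovers the assertion stored in an invariant. -/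
theorem exists_dist_inj {n : ℕ} {a : Agree α} (h : a.valid n) : ∃ y, dist n a (inj y) := by
  induction a using Quotient.inductionOn with | _ a
  obtain ⟨h₁, h₂⟩ : AgreeRaw.rvalid n a := h
  exact ⟨a.c n, fun m hm => ⟨fun _ => trivial, fun _ => a.down _ _ hm h₁⟩,
    fun m hm _ => (COFE.dist_equiv m).symm (h₂ m hm)⟩

theorem dist_of_dist_inj {n : ℕ} {y z : α} (h : dist n (inj y) (inj z)) : dist n y z :=
  (show AgreeRaw.rdist n _ _ from h).2 n le_rfl trivial

end Agree

/-! ## Laws of finite maps -/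

namespace FMap

variable {A : Type u}

@[ext]
theorem ext {f g : FMap A} (h : ∀ k, f.get k = g.get k) : f = g := by
  cases f; cases g
  congr
  exact funext h

theorem mergeWith_comm {g : A → A → A} (hg : ∀ a b, g a b = g b a) (f₁ f₂ : FMap A) :
    f₁.mergeWith g f₂ = f₂.mergeWith g f₁ := by
  ext1 k
  simp only [mergeWith]
  cases f₁.get k <;> cases f₂.get k <;> simp [Option.merge]
  exact hg _ _

theorem mergeWith_assoc {g : A → A → A} (hg : ∀ a b c, g (g a b) c = g a (g b c))
    (f₁ f₂ f₃ : FMap A) :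
    (f₁.mergeWith g f₂).mergeWith g f₃ = f₁.mergeWith g (f₂.mergeWith g f₃) := by
  ext1 k
  simp only [mergeWith]
  cases f₁.get k <;> cases f₂.get k <;> cases f₃.get k <;> simp [Option.merge, hg]

theorem empty_mergeWith {g : A → A → A} (f : FMap A) : (empty : FMap A).mergeWith g f = f := by
  ext1 k
  simp only [mergeWith, empty]
  cases f.get k <;> rfl

theorem dist_equiv [HasDist A] {n : ℕ} (e : Equivalence (dist n : A → A → Prop)) :
    Equivalence (dist n : FMap A → FMap A → Prop) where
  refl f k := by
    cases h : f.get k with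
    | none => exact .none
    | some a => exact .some (e.refl a)
  symm {a b} h k := by
    have h₁ := h k
    generalize a.get k = a' at *
    generalize b.get k = b' at *
    cases h₁ with
    | none => exact .none
    | some h => exact .some (e.symm h)
  trans {a b c} h h' k := by
    have h₁ := h k
    have h₂ := h' k
    generalize a.get k = a' at *
    generalize b.get k = b' at *
    generalize c.get k = c' at *
    cases h₁ with
    | none => exact h₂
    | some h₁ => cases h₂ with | some h₂ => exact .some (e.trans h₁ h₂)

theorem mergeWith_ne [HasDist A] {n : ℕ} {g : A → A → A}
    (hg : ∀ a a' b b' : A, dist n a a' → dist n b b' → dist n (g a b) (g a' b'))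
    {f₁ f₁' f₂ f₂' : FMap A} (h₁ : dist n f₁ f₁') (h₂ : dist n f₂ f₂') :
    dist n (f₁.mergeWith g f₂) (f₁'.mergeWith g f₂') := by
  intro k
  have k₁ := h₁ k
  have k₂ := h₂ k
  simp only [mergeWith]
  generalize f₁.get k = a at *
  generalize f₂.get k = b at *
  generalize f₁'.get k = a' at *
  generalize f₂'.get k = b' at *
  cases k₁ with
  | none => cases k₂ with
    | none => exact .none
    | some h => exact .some h
  | some h => cases k₂ with
    | none => exact .some h
    | some h' => exact .some (hg _ _ _ _ h h')

theorem dom_eq_of_dist [HasDist A] {n : ℕ} {f₁ f₂ : FMap A} (h : dist n f₁ f₂) :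
    f₁.dom = f₂.dom := by
  ext k
  have := h k
  simp only [dom, Set.mem_ofPred_eq]
  generalize f₁.get k = a at *
  generalize f₂.get k = b at *
  cases this <;> simp

theorem eq_empty_of_dist [HasDist A] {n : ℕ} {f : FMap A} (h : dist n f empty) : f = empty := by
  ext1 k
  have := h k
  simp only [empty] at *
  generalize f.get k = a at *
  cases this
  rfl

/-- A property that passes from a composition to both parts holds of the entries of a finite map
whenever it holds of their composition. -/
theorem of_prod {g : A → A → A} {one : A} {p : A → Prop} (hl : ∀ a b, p (g a b) → p a)
    (hr : ∀ a b, p (g a b) → p b) (f : FMap A) (h : p (f.prod g one)) {k : ℕ} {a : A}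
    (hk : f.get k = some a) : p a := by
  have key : ∀ l : List ℕ, k ∈ l →
      p (l.foldr (fun k acc => g ((f.get k).getD one) acc) one) → p a := by
    intro l
    induction l with
    | nil => simp
    | cons j l ih =>
      intro hm hp
      rcases List.mem_cons.1 hm with rfl | hm
      · simpa [hk] using hl _ _ hp
      · exact ih hm (hr _ _ hp)
  exact key _ (by simp [hk]) h

end FMap

/-! ## Laws of the physical state component -/

namespace PhysRes

variable {S : Type u}

theorem op_comm (a b : PhysRes S) : a.op b = b.op a := by cases a <;> cases b <;> rfl

theorem op_assoc (a b c : PhysRes S) : (a.op b).op c = a.op (b.op c) := by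
  cases a <;> cases b <;> cases c <;> rfl

theorem ne_bot_of_op {a b : PhysRes S} (h : a.op b ≠ .bot) : a ≠ .bot := by
  rintro rfl
  cases b <;> exact h rfl

theorem unit_op (a : PhysRes S) : PhysRes.unit.op a = a := by cases a <;> rfl

end PhysRes

/-! ## Executions -/

namespace Lang

variable {L : Lang.{u}}

theorem CStep.lt_length {i : ℕ} {C C' : L.Config} (h : L.CStep i C C') : i < C.1.length := by
  obtain ⟨T, T', e, e', σ, σ', f, rfl, -, rfl, -⟩ := h
  simp

theorem CStep.length_le {i : ℕ} {C C' : L.Config} (h : L.CStep i C C') :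
    C.1.length ≤ C'.1.length := by
  obtain ⟨T, T', e, e', σ, σ', f, rfl, -, rfl, rfl⟩ := h
  simp

theorem CStep.getElem?_of_ne {i j : ℕ} {C C' : L.Config} (h : L.CStep i C C') (hij : j ≠ i)
    (hj : j < C.1.length) : C'.1[j]? = C.1[j]? := by
  obtain ⟨T, T', e, e', σ, σ', f, rfl, -, rfl, rfl⟩ := h
  simp only [List.append_assoc, List.length_append, List.length_cons, List.length_nil] at *
  rcases lt_or_gt_of_ne hij with h | h
  · simp [List.getElem?_append_left h]
  · rw [List.getElem?_append_right h.le, List.getElem?_append_right h.le]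
    obtain ⟨k, hk⟩ : ∃ k, j - T.length = k + 1 := ⟨j - T.length - 1, by omega⟩
    simp only [hk, List.cons_append, List.nil_append, List.getElem?_cons_succ]
    rw [List.getElem?_append_left (by omega)]

theorem CStep.exists_prim {i : ℕ} {C C' : L.Config} (h : L.CStep i C C') {e : L.Expr}
    (he : C.1[i]? = some e) : ∃ e' f, L.prim e C.2 e' C'.2 f ∧ C'.1[i]? = some e' := by
  obtain ⟨T, T', e₁, e', σ, σ', f, rfl, hp, rfl, rfl⟩ := h
  simp at he
  subst he
  exact ⟨e', f, hp, by simp⟩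

theorem CStep.of_singleton {i : ℕ} {e : L.Expr} {σ : L.State} {C' : L.Config}
    (h : L.CStep i ([e], σ) C') :
    ∃ e' σ' f, L.prim e σ e' σ' f ∧ C' = (e' :: f.toList, σ') := by
  have h0 : i = 0 := by simpa using h.lt_length
  obtain ⟨T, T', e₁, e', σ, σ', f, hT, hp, hC, rfl⟩ := h
  subst h0
  rw [List.length_eq_zero_iff] at hT
  subst hT
  simp at hC
  obtain ⟨⟨rfl, rfl⟩, rfl⟩ := hC
  exact ⟨e', σ', f, hp, by simp⟩

theorem Run.length_eq {C C' : L.Config} {js : List ℕ} {cs : List L.Config}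
    (h : L.Run C js cs C') : js.length = cs.length := by
  induction h with
  | nil => rfl
  | cons _ _ ih => simp [ih]

theorem Run.length_le {C C' : L.Config} {js : List ℕ} {cs : List L.Config}
    (h : L.Run C js cs C') : C.1.length ≤ C'.1.length := by
  induction h with
  | nil => exact le_rfl
  | cons h _ ih => exact h.length_le.trans ih

theorem Run.of_append {C C' : L.Config} {js js' : List ℕ} {cs cs' : List L.Config}
    (h : L.Run C (js ++ js') (cs ++ cs') C') (hl : js.length = cs.length) :
    ∃ C₁, L.Run C js cs C₁ ∧ L.Run C₁ js' cs' C' := by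
  induction js generalizing C cs with
  | nil =>
    obtain rfl : cs = [] := by simpa using hl.symm
    exact ⟨C, .nil C, h⟩
  | cons j js ih =>
    cases cs with
    | nil => simp at hl
    | cons c cs =>
      cases h with
      | cons h₁ h₂ =>
        obtain ⟨C₁, h₃, h₄⟩ := ih h₂ (by simpa using hl)
        exact ⟨C₁, .cons h₁ h₃, h₄⟩

theorem Run.getLast_eq {C C' : L.Config} {js : List ℕ} {cs : List L.Config}
    (h : L.Run C js cs C') : (C :: cs).getLast? = some C' := by
  induction h with
  | nil => rfl
  | cons _ _ ih => simpa [List.getLast?_cons] using ih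

theorem Run.getElem?_of_notMem {C C' : L.Config} {js : List ℕ} {cs : List L.Config}
    (h : L.Run C js cs C') {i : ℕ} (hi : i ∉ js) (hl : i < C.1.length) :
    C'.1[i]? = C.1[i]? := by
  induction h with
  | nil => rfl
  | cons h _ ih =>
    simp only [List.mem_cons, not_or] at hi
    rw [ih hi.2 (hl.trans_le h.length_le), h.getElem?_of_ne hi.1 hl]

theorem Run.exists_prim_of_mem {C C' : L.Config} {js : List ℕ} {cs : List L.Config}
    (h : L.Run C js cs C') (hn : js.Nodup) {i : ℕ} (hi : i ∈ js) {e : L.Expr}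
    (he : C.1[i]? = some e) :
    ∃ e' σ σ' f, L.prim e σ e' σ' f ∧ C'.1[i]? = some e' := by
  induction h with
  | nil => simp at hi
  | @cons C C₁ C' j js cs h h₂ ih =>
    rw [List.nodup_cons] at hn
    by_cases hij : i = j
    · subst hij
      obtain ⟨e', f, hp, he'⟩ := h.exists_prim he
      refine ⟨e', _, _, f, hp, ?_⟩
      rw [h₂.getElem?_of_notMem hn.1 (h.lt_length.trans_le h.length_le), he']
    · have hlt : i < C.1.length := (List.getElem?_eq_some_iff.1 he).1
      refine ih hn.2 (by simpa [hij] using hi) ?_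
      rw [h.getElem?_of_ne hij hlt, he]

/-- With bounded non-determinism, there are finitely many runs of bounded length. -/
theorem BoundedNondet.finite_run (hfin : L.BoundedNondet) (n : ℕ) (C : L.Config) :
    {p : List ℕ × List L.Config | p.1.length ≤ n ∧ ∃ C', L.Run C p.1 p.2 C'}.Finite := by
  induction n generalizing C with
  | zero =>
    refine (Set.finite_singleton ([], [])).subset ?_
    rintro ⟨js, cs⟩ ⟨hl, C', h⟩
    obtain rfl : js = [] := by simpa using hl
    cases h
    rfl
  | succ n ih =>
    -- Bounded non-determinism counts successors only. The thread that takes the step is bounded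
    -- separately, by the length of the pool.
    have hsub : {p : List ℕ × List L.Config | p.1.length ≤ n + 1 ∧ ∃ C', L.Run C p.1 p.2 C'} ⊆
        {([], [])} ∪ ⋃ C₁ ∈ {C₁ | ∃ i, L.CStep i C C₁}, ⋃ i ∈ Set.Iio C.1.length,
          (fun p : List ℕ × List L.Config => (i :: p.1, C₁ :: p.2)) ''
            {p | p.1.length ≤ n ∧ ∃ C', L.Run C₁ p.1 p.2 C'} := by
      rintro ⟨js, cs⟩ ⟨hl, C', h⟩
      cases h with
      | nil => exact Or.inl rfl
      | @cons _ C₁ _ j js cs h₁ h₂ =>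
        refine Or.inr (Set.mem_biUnion (show C₁ ∈ _ from ⟨j, h₁⟩)
          (Set.mem_biUnion (show j ∈ Set.Iio _ from h₁.lt_length) ?_))
        exact ⟨(js, cs), ⟨by simpa using hl, C', h₂⟩, rfl⟩
    exact ((Set.finite_singleton _).union ((hfin C).biUnion fun C₁ _ =>
      (Set.finite_Iio _).biUnion fun i _ => (ih C₁).image _)).subset hsub

/-- A property of configurations which can always be reestablished by a non-empty run gives rise
to a diverging execution. -/
theorem exists_diverges (p : L.Config → Prop)
    (hp : ∀ C, p C → ∃ js cs C', js ≠ [] ∧ L.Run C js cs C' ∧ p C') {C : L.Config} (hC : p C) :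
    ∃ F, L.Diverges C F := by
  -- Unlike `p`, the property of having a pending, possibly empty, run to `p` can be reestablished
  -- after every single step; an exhausted run is renewed by `hp`.
  let D : L.Config → Prop := fun C => ∃ js cs C', L.Run C js cs C' ∧ p C'
  have step : ∀ C : {C // D C}, ∃ q : ℕ × {C // D C}, L.CStep q.1 C.1 q.2.1 := by
    rintro ⟨C, js, cs, C', h, hC'⟩
    have key : ∃ js cs C', js ≠ [] ∧ L.Run C js cs C' ∧ p C' := by
      cases h with
      | nil => exact hp _ hC'
      | cons h₁ h₂ => exact ⟨_, _, _, List.cons_ne_nil _ _, .cons h₁ h₂, hC'⟩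
    obtain ⟨js, cs, C', hne, h, hC'⟩ := key
    cases h with
    | nil => exact absurd rfl hne
    | cons h₁ h₂ => exact ⟨(_, ⟨_, _, _, _, h₂, hC'⟩), h₁⟩
  choose next hnext using step
  let G : ℕ → {C // D C} := fun n => (fun c => (next c).2)^[n] ⟨C, [], [], C, .nil C, hC⟩
  refine ⟨fun n => ((G n).1, (next (G n)).1), rfl, fun n => ?_⟩
  have : G (n + 1) = (next (G n)).2 := Function.iterate_succ_apply' _ _ _
  simpa only [this] using hnext (G n)

end Lang

/-! ## Laws of the algebra of source executions -/

section Refinement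

variable {Λ : Lang.{v}}

theorem RefValid.mono {K K' : Finset ℕ} {cfgs : List Λ.Config} {idxs : List ℕ}
    (h : RefValid Λ K cfgs idxs) (hK : K' ⊆ K) : RefValid Λ K' cfgs idxs := by
  rcases h with ⟨h₁, h₂, rfl⟩ | ⟨C₀, cs, C, h₁, h₂, h₃⟩
  · exact Or.inl ⟨h₁, h₂, Finset.subset_empty.1 hK⟩
  · exact Or.inr ⟨C₀, cs, C, h₁, h₂, fun i hi => h₃ i (hK hi)⟩

theorem longer_of_prefix {A : Type u} {l₁ l₂ : List A} (h : l₁ <+: l₂) : longer l₁ l₂ = l₂ :=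
  if_pos h.length_le

theorem longer_of_prefix' {A : Type u} {l₁ l₂ : List A} (h : l₂ <+: l₁) : longer l₁ l₂ = l₁ := by
  unfold longer
  split_ifs with hl
  · exact h.eq_of_length_le hl
  · rfl

theorem longer_assoc {A : Type u} (l₁ l₂ l₃ : List A) :
    longer (longer l₁ l₂) l₃ = longer l₁ (longer l₂ l₃) := by
  unfold longer
  split_ifs <;> first | rfl | omega

theorem View.max_comm (a b : View) : a.max b = b.max a := by cases a <;> cases b <;> rfl

theorem View.max_assoc (a b c : View) : (a.max b).max c = a.max (b.max c) := by
  cases a <;> cases b <;> cases c <;> rfl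

theorem View.max_eq_master {a b : View} : a.max b = .master ↔ a = .master ∨ b = .master := by
  cases a <;> cases b <;> simp [View.max]

namespace RefElem

attribute [ext] RefElem

/-- The execution of `a` is a prefix of that of `b`. -/
def Pre (a b : RefElem Λ) : Prop := a.cfgs <+: b.cfgs ∧ a.idxs <+: b.idxs

/-- The threads in `K` take no steps after the execution of `a` and before the end of that of
`b`. -/
def Idle (K : Finset ℕ) (a b : RefElem Λ) : Prop := ∀ i ∈ K, i ∉ b.idxs.drop a.idxs.length

/-- Separates the order on executions from the idleness condition, so that the two can be composed
and split independently. -/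
theorem ext_iff_pre {a b : RefElem Λ} : a.Ext b ↔ a.Pre b ∧ Idle a.tids a b := by
  constructor
  · rintro ⟨cs, js, h₁, h₂, h₃⟩
    refine ⟨⟨⟨cs, h₁.symm⟩, ⟨js, h₂.symm⟩⟩, ?_⟩
    simpa [Idle, h₂] using h₃
  · rintro ⟨⟨⟨cs, h₁⟩, ⟨js, h₂⟩⟩, h₃⟩
    refine ⟨cs, js, h₁.symm, h₂.symm, ?_⟩
    simpa [Idle, ← h₂] using h₃

theorem Pre.trans {a b c : RefElem Λ} (h : a.Pre b) (h' : b.Pre c) : a.Pre c :=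
  ⟨h.1.trans h'.1, h.2.trans h'.2⟩

theorem idle_trans {K : Finset ℕ} {a b c : RefElem Λ} (h : a.Pre b) (h' : b.Pre c) :
    Idle K a c ↔ Idle K a b ∧ Idle K b c := by
  obtain ⟨-, js, h⟩ := h
  obtain ⟨-, js', h'⟩ := h'
  simp only [Idle, ← h', ← h, List.append_assoc, List.drop_left', List.length_append]
  rw [← List.append_assoc a.idxs, ← List.length_append, List.drop_left]
  simp only [List.mem_append, not_or]
  exact ⟨fun h => ⟨fun i hi => (h i hi).1, fun i hi => (h i hi).2⟩,
    fun h i hi => ⟨h.1 i hi, h.2 i hi⟩⟩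

theorem idle_of_pre {K : Finset ℕ} {a b : RefElem Λ} (h : b.Pre a) : Idle K a b := by
  intro i _
  simp [List.drop_eq_nil_of_le h.2.length_le]

/-- Ties the two lists together, so that comparing the lengths of `cfgs` also compares those of
`idxs` in `pre_total`. For the empty execution the truncated subtraction gives `0`. -/
theorem idxs_length (a : RefElem Λ) : a.idxs.length = a.cfgs.length - 1 := by
  rcases a.valid with ⟨h₁, h₂, -⟩ | ⟨C₀, cs, C, h₁, h₂, -⟩
  · simp [h₁, h₂]
  · simp [h₁, h₂.length_eq]

theorem pre_total {a b c : RefElem Λ} (h : a.Pre c) (h' : b.Pre c) : a.Pre b ∨ b.Pre a := by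
  have ha := a.idxs_length
  have hb := b.idxs_length
  rcases le_total a.cfgs.length b.cfgs.length with hl | hl
  · exact Or.inl ⟨List.prefix_of_prefix_length_le h.1 h'.1 hl,
      List.prefix_of_prefix_length_le h.2 h'.2 (by omega)⟩
  · exact Or.inr ⟨List.prefix_of_prefix_length_le h'.1 h.1 hl,
      List.prefix_of_prefix_length_le h'.2 h.2 (by omega)⟩

/-- Replaces the case distinction on views by a symmetric, purely propositional form. -/
theorem compat_iff {a b : RefElem Λ} : a.Compat b ↔
    Disjoint a.tids b.tids ∧ (a.Ext b ∨ b.Ext a) ∧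
      (a.view = .master → b.view ≠ .master ∧ b.Ext a) ∧
      (b.view = .master → a.view ≠ .master ∧ a.Ext b) := by
  unfold Compat
  cases a.view <;> cases b.view <;> simp <;> tauto

theorem Compat.symm {a b : RefElem Λ} (h : a.Compat b) : b.Compat a := by
  rw [compat_iff] at h ⊢
  exact ⟨h.1.symm, h.2.1.symm, h.2.2.2, h.2.2.1⟩

/-- Thread pools never shrink along a run, so the threads of `a` still exist at the end of `b`.
Hence the validity condition in `RefRes.op` follows from compatibility. -/
theorem refValid_of_ext {a b : RefElem Λ} (h : a.Ext b) :
    RefValid Λ (a.tids ∪ b.tids) b.cfgs b.idxs := by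
  obtain ⟨cs', js', h₁, h₂, -⟩ := h
  rcases a.valid with ⟨-, -, h₃⟩ | ⟨C₀, cs, C, h₃, h₄, h₅⟩
  · simpa [h₃] using b.valid
  · rcases b.valid with ⟨h₆, -, -⟩ | ⟨D₀, ds, D, h₆, h₇, h₈⟩
    · simp [h₃, h₆] at h₁
    · refine Or.inr ⟨D₀, ds, D, h₆, h₇, fun i hi => ?_⟩
      rcases Finset.mem_union.1 hi with hi | hi
      · rw [h₆, h₃, List.cons_append, List.cons.injEq] at h₁
        obtain ⟨rfl, rfl⟩ := h₁
        rw [h₂] at h₇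
        -- Cut the run of `b` where that of `a` ends; both initial parts reach the same
        -- configuration, since it is the last one listed.
        obtain ⟨C₁, k₁, k₂⟩ := h₇.of_append h₄.length_eq
        have e : some C₁ = some C := by rw [← k₁.getLast_eq, h₄.getLast_eq]
        cases e
        exact (h₅ i hi).trans_le k₂.length_le
      · exact h₈ i hi

theorem Ext.longer_eq {a b : RefElem Λ} (h : a.Ext b) :
    longer a.cfgs b.cfgs = b.cfgs ∧ longer a.idxs b.idxs = b.idxs :=
  have h := (ext_iff_pre.1 h).1
  ⟨longer_of_prefix h.1, longer_of_prefix h.2⟩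

theorem Ext.longer_eq' {a b : RefElem Λ} (h : b.Ext a) :
    longer a.cfgs b.cfgs = a.cfgs ∧ longer a.idxs b.idxs = a.idxs :=
  have h := (ext_iff_pre.1 h).1
  ⟨longer_of_prefix' h.1, longer_of_prefix' h.2⟩

theorem Compat.refValid {a b : RefElem Λ} (h : a.Compat b) :
    RefValid Λ (a.tids ∪ b.tids) (longer a.cfgs b.cfgs) (longer a.idxs b.idxs) := by
  rcases (compat_iff.1 h).2.1 with h | h
  · rw [(Ext.longer_eq h).1, (Ext.longer_eq h).2]
    exact refValid_of_ext h
  · rw [(Ext.longer_eq' h).1, (Ext.longer_eq' h).2, Finset.union_comm]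
    exact refValid_of_ext h

/-- The composition of compatible elements. -/
def join (a b : RefElem Λ) (h : a.Compat b) : RefElem Λ :=
  ⟨a.view.max b.view, a.tids ∪ b.tids, longer a.cfgs b.cfgs, longer a.idxs b.idxs, h.refValid⟩

theorem join_comm {a b : RefElem Λ} (h : a.Compat b) : a.join b h = b.join a h.symm := by
  have key : longer a.cfgs b.cfgs = longer b.cfgs a.cfgs ∧
      longer a.idxs b.idxs = longer b.idxs a.idxs := by
    rcases (compat_iff.1 h).2.1 with h | h
    · rw [(Ext.longer_eq h).1, (Ext.longer_eq h).2, (Ext.longer_eq' h).1,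
        (Ext.longer_eq' h).2]
      exact ⟨rfl, rfl⟩
    · rw [(Ext.longer_eq h).1, (Ext.longer_eq h).2, (Ext.longer_eq' h).1,
        (Ext.longer_eq' h).2]
      exact ⟨rfl, rfl⟩
  ext1
  · exact View.max_comm _ _
  · exact Finset.union_comm _ _
  · exact key.1
  · exact key.2

/-- The join carries the execution of the longer element `b`, so extension to and from `c` reduces
to statements about `a` and `b`. Prefixes of a common execution are comparable, and idleness passes
to subintervals; what remains is propositional. -/
theorem compat_join_iff_of_ext {a b c : RefElem Λ} (h : a.Compat b) (hab : a.Ext b) :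
    (a.join b h).Compat c ↔ a.Compat c ∧ b.Compat c := by
  have hm := (compat_iff.1 h).2.2
  have hpre := (ext_iff_pre.1 hab).1
  have hidle := (ext_iff_pre.1 hab).2
  have hd : (a.join b h).tids = a.tids ∪ b.tids := rfl
  have hv : (a.join b h).view = a.view.max b.view := rfl
  have h₁ : (a.join b h).cfgs = b.cfgs := (Ext.longer_eq hab).1
  have h₂ : (a.join b h).idxs = b.idxs := (Ext.longer_eq hab).2
  have hE : (a.join b h).Ext c ↔ a.Ext c ∧ b.Ext c := by
    simp only [ext_iff_pre, Pre, Idle, h₁, h₂, hd]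
    constructor
    · rintro ⟨k₁, k₂⟩
      have hbc : b.Pre c := k₁
      refine ⟨⟨hpre.trans hbc, (idle_trans hpre hbc).2 ⟨hidle, fun i hi => k₂ i ?_⟩⟩,
        k₁, fun i hi => k₂ i ?_⟩
      · exact Finset.mem_union_left _ hi
      · exact Finset.mem_union_right _ hi
    · rintro ⟨⟨k₁, k₂⟩, hbc, k₃⟩
      refine ⟨hbc, fun i hi => ?_⟩
      rcases Finset.mem_union.1 hi with hi | hi
      · exact ((idle_trans hpre hbc).1 k₂).2 i hi
      · exact k₃ i hi
  have hE' : c.Ext (a.join b h) ↔ c.Ext b := by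
    simp only [ext_iff_pre, Pre, Idle, h₁, h₂]
  have hcb : c.Ext b → a.Ext c ∨ c.Ext a := by
    intro hc
    have hc := ext_iff_pre.1 hc
    rcases pre_total hpre hc.1 with k | k
    · exact Or.inl (ext_iff_pre.2 ⟨k, ((idle_trans k hc.1).1 hidle).1⟩)
    · exact Or.inr (ext_iff_pre.2 ⟨k, ((idle_trans k hpre).1 hc.2).1⟩)
  -- If `c` is also a prefix of `a`, no steps lie between `a` and `c`, so idleness is vacuous.
  have hbca : b.Ext c → a.Ext c ∨ c.Ext a → a.Ext c := by
    rintro hbc (hac | hca)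
    · exact hac
    · have hca := ext_iff_pre.1 hca
      have hbc := ext_iff_pre.1 hbc
      refine ext_iff_pre.2 ⟨hpre.trans hbc.1, idle_of_pre hca.1⟩
  -- When `a` is a master, `b` extends to `a` as well, so the two executions coincide and may be
  -- exchanged.
  have hba : b.Ext a → c.Ext b → c.Ext a := by
    intro hba hc
    have hc := ext_iff_pre.1 hc
    have hba := (ext_iff_pre.1 hba).1
    exact ext_iff_pre.2 ⟨hc.1.trans hba, (idle_trans hc.1 hba).2 ⟨hc.2, idle_of_pre hpre⟩⟩
  have hab' : b.Ext a → c.Ext a → c.Ext b := by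
    intro hba hc
    have hc := ext_iff_pre.1 hc
    have hba := (ext_iff_pre.1 hba).1
    exact ext_iff_pre.2 ⟨hc.1.trans hpre, (idle_trans hc.1 hpre).2 ⟨hc.2, idle_of_pre hba⟩⟩
  simp only [compat_iff, hE, hE', hd, hv, View.max_eq_master, Finset.disjoint_union_left, ne_eq,
    not_or]
  clear hd hv h₁ h₂ hE hE' hpre hidle h
  generalize a.Ext b = ab at *
  generalize b.Ext a = ba at *
  generalize a.Ext c = ac at *
  generalize c.Ext a = ca at *
  generalize b.Ext c = bc at *
  generalize c.Ext b = cb at *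
  generalize (a.view = .master) = va at *
  generalize (b.view = .master) = vb at *
  generalize (c.view = .master) = vc at *
  grind

theorem compat_join_iff {a b c : RefElem Λ} (h : a.Compat b) :
    (a.join b h).Compat c ↔ a.Compat c ∧ b.Compat c := by
  rcases (compat_iff.1 h).2.1 with k | k
  · exact compat_join_iff_of_ext h k
  · rw [join_comm, compat_join_iff_of_ext h.symm k, and_comm]

end RefElem

namespace RefRes

theorem el_op_el {a b : RefElem Λ} (h : a.Compat b) : op (.el a) (.el b) = .el (a.join b h) :=
  dif_pos ⟨h, h.refValid⟩

theorem el_op_el_of_not {a b : RefElem Λ} (h : ¬ a.Compat b) : op (.el a) (.el b) = .bot :=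
  dif_neg fun h' => h h'.1

theorem op_bot (a : RefRes Λ) : a.op .bot = .bot := by cases a <;> rfl

theorem bot_op (a : RefRes Λ) : RefRes.bot.op a = .bot := rfl

theorem op_comm (a b : RefRes Λ) : a.op b = b.op a := by
  cases a with
  | bot => rw [bot_op, op_bot]
  | el a =>
    cases b with
    | bot => rw [bot_op, op_bot]
    | el b =>
      by_cases h : a.Compat b
      · rw [el_op_el h, el_op_el h.symm, RefElem.join_comm]
      · rw [el_op_el_of_not h, el_op_el_of_not fun h' => h h'.symm]

/-- By `RefElem.compat_join_iff`, either bracketing is defined exactly when the three elements are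
pairwise compatible. -/
theorem op_assoc (a b c : RefRes Λ) : (a.op b).op c = a.op (b.op c) := by
  cases a with
  | bot => rfl
  | el a =>
    cases b with
    | bot => rfl
    | el b =>
      cases c with
      | bot => simp only [op_bot]
      | el c =>
        by_cases hab : a.Compat b <;> by_cases hbc : b.Compat c
        · rw [el_op_el hab, el_op_el hbc]
          have hiff : a.Compat (b.join c hbc) ↔ a.Compat c := by
            have k := RefElem.compat_join_iff (c := a) hbc
            refine ⟨fun h => (k.1 h.symm).2.symm, fun h => (k.2 ⟨hab.symm, h.symm⟩).symm⟩
          by_cases hac : a.Compat c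
          · rw [el_op_el ((RefElem.compat_join_iff hab).2 ⟨hac, hbc⟩), el_op_el (hiff.2 hac)]
            congr 1
            ext1
            · exact View.max_assoc _ _ _
            · exact Finset.union_assoc _ _ _
            · exact longer_assoc _ _ _
            · exact longer_assoc _ _ _
          · rw [el_op_el_of_not fun h => hac ((RefElem.compat_join_iff hab).1 h).1,
              el_op_el_of_not fun h => hac (hiff.1 h)]
        · rw [el_op_el hab, el_op_el_of_not hbc, op_bot,
            el_op_el_of_not fun h => hbc ((RefElem.compat_join_iff hab).1 h).2]
        · rw [el_op_el_of_not hab, el_op_el hbc, bot_op, el_op_el_of_not fun h => hab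
            ((RefElem.compat_join_iff hbc).1 h.symm).1.symm]
        · rw [el_op_el_of_not hab, el_op_el_of_not hbc, bot_op, op_bot]

theorem ne_bot_of_op {a b : RefRes Λ} (h : a.op b ≠ .bot) : a ≠ .bot := by
  rintro rfl
  exact h rfl

theorem unit_op (a : RefRes Λ) : RefRes.unit.op a = a := by
  cases a with
  | bot => rfl
  | el a =>
    have hE : RefElem.Ext ⟨.snapshot, ∅, [], [], Or.inl ⟨rfl, rfl, rfl⟩⟩ a :=
      ⟨a.cfgs, a.idxs, rfl, rfl, by simp⟩
    have h : RefElem.Compat ⟨.snapshot, ∅, [], [], Or.inl ⟨rfl, rfl, rfl⟩⟩ a := by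
      refine ⟨by simp, ?_⟩
      cases hv : a.view
      · exact hE
      · exact Or.inl hE
    rw [unit, el_op_el h]
    congr 1
    ext1
    · cases hv : a.view <;> simp [RefElem.join, hv, View.max]
    · simp [RefElem.join]
    · exact (RefElem.Ext.longer_eq hE).1
    · exact (RefElem.Ext.longer_eq hE).2

/-- The control of the threads of a snapshot can be split. -/
theorem snapshot_op {K₁ K₂ : Finset ℕ} {cfgs : List Λ.Config} {idxs : List ℕ}
    (h₁ : RefValid Λ K₁ cfgs idxs) (h₂ : RefValid Λ K₂ cfgs idxs)
    (h : RefValid Λ (K₁ ∪ K₂) cfgs idxs) (hd : Disjoint K₁ K₂) :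
    op (.el ⟨.snapshot, K₁, cfgs, idxs, h₁⟩) (.el ⟨.snapshot, K₂, cfgs, idxs, h₂⟩) =
      .el ⟨.snapshot, K₁ ∪ K₂, cfgs, idxs, h⟩ := by
  have hc : RefElem.Compat ⟨.snapshot, K₁, cfgs, idxs, h₁⟩ ⟨.snapshot, K₂, cfgs, idxs, h₂⟩ :=
    ⟨hd, Or.inl ⟨[], [], by simp, by simp, by simp⟩⟩
  rw [el_op_el hc]
  congr 1
  ext1
  · rfl
  · rfl
  · exact longer_of_prefix List.prefix_rfl
  · exact longer_of_prefix List.prefix_rfl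

end RefRes

end Refinement

/-! ## Laws of global resources -/

namespace Res

attribute [ext] Res

variable {Tgt : Lang.{u}} {Src : Lang.{v}} {G : Type w} {X : Type x} [COFE X] [UCMRA G]

theorem op_comm (a b : Res Tgt Src G X) : op a b = op b a := by
  ext1
  · exact FMap.mergeWith_comm Agree.op_comm _ _
  · exact PhysRes.op_comm _ _
  · exact RefRes.op_comm _ _
  · exact UCMRA.op_comm _ _

theorem op_assoc (a b c : Res Tgt Src G X) : op (op a b) c = op a (op b c) := by
  ext1
  · exact FMap.mergeWith_assoc Agree.op_assoc _ _ _
  · exact PhysRes.op_assoc _ _ _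
  · exact RefRes.op_assoc _ _ _
  · exact UCMRA.op_assoc _ _ _

theorem unit_op (a : Res Tgt Src G X) : op unit a = a := by
  ext1
  · exact FMap.empty_mergeWith _
  · exact PhysRes.unit_op _
  · exact RefRes.unit_op _
  · exact UCMRA.unit_op _

theorem op_unit (a : Res Tgt Src G X) : op a unit = a := by
  rw [op_comm, unit_op]

theorem core_unit : core (unit : Res Tgt Src G X) = unit := by
  ext1
  · rfl
  · rfl
  · rfl
  · exact UCMRA.core_unit

theorem dist_equiv (n : ℕ) :
    Equivalence (dist n : Res Tgt Src G X → Res Tgt Src G X → Prop) where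
  refl a := ⟨(FMap.dist_equiv (Agree.dist_equiv n)).refl _, rfl, rfl, (COFE.dist_equiv n).refl _⟩
  symm h := ⟨(FMap.dist_equiv (Agree.dist_equiv n)).symm h.1, h.2.1.symm, h.2.2.1.symm,
    (COFE.dist_equiv n).symm h.2.2.2⟩
  trans h h' := ⟨(FMap.dist_equiv (Agree.dist_equiv n)).trans h.1 h'.1, h.2.1.trans h'.2.1,
    h.2.2.1.trans h'.2.2.1, (COFE.dist_equiv n).trans h.2.2.2 h'.2.2.2⟩

theorem dist_refl (n : ℕ) (a : Res Tgt Src G X) : dist n a a := (dist_equiv n).refl a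

theorem dist_mono {n m : ℕ} {a b : Res Tgt Src G X} (hm : m ≤ n) (h : dist n a b) :
    dist m a b := by
  refine ⟨fun k => ?_, h.2.1, h.2.2.1, COFE.dist_mono _ _ _ _ hm h.2.2.2⟩
  have := h.1 k
  generalize a.wld.get k = a' at *
  generalize b.wld.get k = b' at *
  cases this with
  | none => exact .none
  | some h => exact .some (Agree.dist_mono hm h)

theorem op_ne {n : ℕ} {a a' b b' : Res Tgt Src G X} (ha : dist n a a') (hb : dist n b b') :
    dist n (op a b) (op a' b') := by
  refine ⟨FMap.mergeWith_ne (fun _ _ _ _ => Agree.op_ne) ha.1 hb.1, ?_, ?_,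
    UCMRA.op_ne _ _ _ _ _ ha.2.2.2 hb.2.2.2⟩
  · exact congrArg₂ PhysRes.op ha.2.1 hb.2.1
  · exact congrArg₂ RefRes.op ha.2.2.1 hb.2.2.1

theorem valid_ne {n : ℕ} {a b : Res Tgt Src G X} (h : dist n a b) (ha : valid n a) :
    valid n b := by
  refine ⟨fun k c hc => ?_, h.2.1 ▸ ha.2.1, h.2.2.1 ▸ ha.2.2.1,
    UCMRA.valid_ne _ _ _ h.2.2.2 ha.2.2.2⟩
  have h₁ := h.1 k
  have h₂ := ha.1 k
  rw [hc] at h₁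
  generalize a.wld.get k = a' at *
  cases h₁ with
  | some h₁ => exact Agree.valid_ne h₁ (h₂ _ rfl)

theorem valid_mono {n m : ℕ} {a : Res Tgt Src G X} (hm : m ≤ n) (h : valid n a) : valid m a :=
  ⟨fun k c hc => Agree.valid_mono hm (h.1 k c hc), h.2.1, h.2.2.1,
    UCMRA.valid_mono _ _ _ hm h.2.2.2⟩

theorem valid_op_left {n : ℕ} {a b : Res Tgt Src G X} (h : valid n (op a b)) : valid n a := by
  refine ⟨fun k c hc => ?_, PhysRes.ne_bot_of_op h.2.1, RefRes.ne_bot_of_op h.2.2.1,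
    UCMRA.valid_op _ _ _ h.2.2.2⟩
  have h₁ : ∀ c, Option.merge Agree.op (a.wld.get k) (b.wld.get k) = some c → c.valid n := h.1 k
  rw [hc] at h₁
  cases hb : b.wld.get k with
  | none => exact h₁ c (by rw [hb]; rfl)
  | some d => exact Agree.valid_op (h₁ (c.op d) (by rw [hb]; rfl))

theorem valid_op_right {n : ℕ} {a b : Res Tgt Src G X} (h : valid n (op a b)) : valid n b := by
  rw [op_comm] at h
  exact valid_op_left h

theorem valid_unit (n : ℕ) : valid n (unit : Res Tgt Src G X) :=
  ⟨fun k c hc => (Option.some_ne_none c hc.symm).elim, by simp [CMRAOps.unit],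
    by simp [CMRAOps.unit, RefRes.unit], UCMRA.unit_valid n⟩

/-- The unit is discrete in each component, even at index `0`. This lets the unused linear resource
of a non-forking step disappear exactly. -/
theorem eq_unit_of_dist {n : ℕ} {a : Res Tgt Src G X} (h : dist n a unit) : a = unit := by
  ext1
  · exact FMap.eq_empty_of_dist h.1
  · exact h.2.1
  · exact h.2.2.1
  · exact (UCMRA.unit_discrete _ ((COFE.dist_equiv 0).symm
      (COFE.dist_mono _ _ _ _ (Nat.zero_le n) h.2.2.2))).symm

theorem step_ne_left {n : ℕ} {a a' b : Res Tgt Src G X} (h : dist n a a') (hs : step n a b) :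
    step n a' b :=
  ⟨h.2.2.1 ▸ hs.1, UCMRA.step_ne _ _ _ _ _ h.2.2.2 ((COFE.dist_equiv n).refl _) hs.2⟩

end Res

/-! ## World satisfaction and weakest preconditions -/

section Logic

variable {Tgt : Lang.{u}} {Src : Lang.{v}} {G : Type w} {X : Type x} [COFE X] [UCMRA G]
  {μ : Model Tgt Src G X}

theorem wsat_ne {E : Set ℕ} {σ : Tgt.State} {n m : ℕ} {r r' s s' : Res Tgt Src G X}
    (hr : dist n r r') (hs : dist n s s') (hm : m ≤ n) (h : wsat μ E σ r s m) :
    wsat μ E σ r' s' m := by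
  cases m with
  | zero => trivial
  | succ m =>
    obtain ⟨rs, h₁, h₂, h₃, h₄⟩ := h
    have hr := Res.op_ne (Res.dist_mono hm hr) (Res.dist_refl _ (rs.prod op unit))
    have hs := Res.dist_mono hm hs
    refine ⟨rs, Res.valid_ne (Res.op_ne hr hs) h₁, hr.2.1 ▸ h₂,
      FMap.dom_eq_of_dist hr.1 ▸ h₃, fun k hk P => ?_⟩
    rintro ⟨c, hc, hd⟩
    have hk' := hr.1 k
    refine h₄ k hk P ?_
    rw [hc] at hk'
    generalize (op r (rs.prod op unit)).wld.get k = c' at *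
    cases hk' with
    | some hk' => exact ⟨_, rfl, (Agree.dist_equiv _).trans hk' hd⟩

theorem wsat.valid {E : Set ℕ} {σ : Tgt.State} {n : ℕ} {r s : Res Tgt Src G X}
    (h : wsat μ E σ r s (n + 1)) : valid (n + 1) r ∧ valid (n + 1) s := by
  obtain ⟨rs, h₁, -⟩ := h
  exact ⟨Res.valid_op_left (Res.valid_op_left h₁), Res.valid_op_right h₁⟩

/-- At a lower index more assertions `P` match a given invariant. Each is `m`-equal to one, `P'`,
that already matched at the higher index; one index is lost to `Later`. -/
theorem wsat_mono {E : Set ℕ} {σ : Tgt.State} {n m : ℕ} {r s : Res Tgt Src G X} (hm : m ≤ n)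
    (h : wsat μ E σ r s n) : wsat μ E σ r s m := by
  rcases m with _ | m
  · trivial
  obtain ⟨n, rfl⟩ : ∃ k, n = k + 1 := ⟨n - 1, by omega⟩
  obtain ⟨rs, h₁, h₂, h₃, h₄⟩ := h
  refine ⟨rs, Res.valid_mono hm h₁, h₂, h₃, fun k hk P => ?_⟩
  rintro ⟨c, hc, hd⟩
  -- Surjectivity of the domain isomorphism turns the stored element into an assertion `P'`.
  obtain ⟨⟨y⟩, hy⟩ := Agree.exists_dist_inj ((Res.valid_op_left h₁).1 k c hc)
  obtain ⟨P', rfl⟩ := μ.iso.surjective y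
  obtain ⟨t, ht, hP⟩ := h₄ k hk P' ⟨c, hc, hy⟩
  have hmn : m ≤ n := by omega
  have ht' : CMRAOps.valid (n + 1) t :=
    FMap.of_prod (fun _ _ => Res.valid_op_left) (fun _ _ => Res.valid_op_right) rs
      (Res.valid_op_right (Res.valid_op_left h₁)) ht
  have hd' := Agree.dist_of_dist_inj ((Agree.dist_equiv (m + 1)).trans
    ((Agree.dist_equiv (m + 1)).symm (Agree.dist_mono hm hy)) hd)
  have hPP : dist m P' P := by
    rcases hd' with hd' | hd'
    · omega
    · exact (μ.iso_dist m P' P).1 (by simpa using hd')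
  refine ⟨t, ht, (hPP _ _ m le_rfl).1 ?_⟩
  exact P'.mono n m t t unit hP ⟨unit, (Res.op_unit t).symm⟩ hmn
    (Res.valid_mono (by omega) ht') (Res.valid_unit m)

theorem wp_mono {E : Set ℕ} {e : Tgt.Expr} {Φ : Tgt.Val → Assn (Res Tgt Src G X)} {n m : ℕ}
    {r s : Res Tgt Src G X} (hm : m ≤ n) (h : wp μ E e Φ n r s) : wp μ E e Φ m r s := by
  rw [wp] at h ⊢
  exact fun k hk => h k (hk.trans_le hm)

theorem wp_ne {E : Set ℕ} {e : Tgt.Expr} (Φ : Tgt.Val → UPred (Res Tgt Src G X)) {n : ℕ}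
    {r r' s s' : Res Tgt Src G X} (hr : dist n r r') (hs : dist n s s')
    (h : wp μ E e (fun v => (Φ v).holds) n r s) : wp μ E e (fun v => (Φ v).holds) n r' s' := by
  rw [wp] at h ⊢
  intro m hm rf sf Ef σ hE hw
  have hr := Res.dist_mono hm hr
  have hs := Res.dist_mono hm hs
  have hs' := (Res.dist_equiv _).symm hs
  have hw' := wsat_ne (Res.op_ne ((Res.dist_equiv _).symm hr) (Res.dist_refl _ rf))
    (Res.op_ne hs' (Res.dist_refl _ sf)) le_rfl hw
  obtain ⟨h₁, h₂⟩ := h m hm rf sf Ef σ hE hw'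
  refine ⟨fun v hv => ?_, fun hv h0 => ?_⟩
  · obtain ⟨r'', k₁, k₂⟩ := h₁ v hv
    exact ⟨r'', (Φ v).ne _ _ _ _ _ (Res.dist_refl _ _) hs k₁,
      wsat_ne (Res.dist_refl _ _) (Res.op_ne hs (Res.dist_refl _ sf)) le_rfl k₂⟩
  · obtain ⟨k₁, k₂⟩ := h₂ hv h0
    refine ⟨k₁, fun e₂ σ₂ f hp => ?_⟩
    obtain ⟨r₁, r₂, s₁, s₂, l₁, l₂, l₃, l₄⟩ := k₂ e₂ σ₂ f hp
    exact ⟨r₁, r₂, s₁, s₂, l₁, l₂, l₃, Res.step_ne_left (Res.dist_mono (Nat.le_succ m) hs) l₄⟩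

/-- The extra affine resource is hidden in the frame; after a step it returns to the continuing
thread, and at a value the postcondition absorbs it. -/
theorem wp_op {E : Set ℕ} {e : Tgt.Expr} (Φ : Tgt.Val → UPred (Res Tgt Src G X)) {n : ℕ}
    {r s : Res Tgt Src G X} (c : Res Tgt Src G X)
    (h : wp μ E e (fun v => (Φ v).holds) n r s) :
    wp μ E e (fun v => (Φ v).holds) n (op r c) s := by
  induction n using Nat.strong_induction_on generalizing e r s with
  | _ n ih =>
  rw [wp] at h ⊢
  intro m hm rf sf Ef σ hE hw
  rw [Res.op_assoc] at hw
  obtain ⟨h₁, h₂⟩ := h m hm (op c rf) sf Ef σ hE hw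
  refine ⟨fun v hv => ?_, fun hv h0 => ?_⟩
  · obtain ⟨r', k₁, k₂⟩ := h₁ v hv
    rw [← Res.op_assoc] at k₂
    refine ⟨op r' c, (Φ v).mono _ _ _ _ _ k₁ ⟨c, rfl⟩ le_rfl ?_ ?_, k₂⟩
    · exact Res.valid_op_left k₂.valid.1
    · exact Res.valid_op_left k₂.valid.2
  · obtain ⟨k₁, k₂⟩ := h₂ hv h0
    refine ⟨k₁, fun e₂ σ₂ f hp => ?_⟩
    obtain ⟨r₁, r₂, s₁, s₂, l₁, l₂, l₃, l₄⟩ := k₂ e₂ σ₂ f hp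
    refine ⟨op r₁ c, r₂, s₁, s₂, ?_, ih m hm l₂, l₃, l₄⟩
    rwa [Res.op_assoc r₁ c r₂, Res.op_comm c r₂, ← Res.op_assoc r₁ r₂ c, Res.op_assoc _ c rf]

/-- `wp` under a frame of linear resources, as a uniform predicate. -/
def wpFrame (μ : Model Tgt Src G X) (E : Set ℕ) (e : Tgt.Expr)
    (Φ : Tgt.Val → UPred (Res Tgt Src G X)) (s : Res Tgt Src G X) : UPred (Res Tgt Src G X) where
  holds n a b := wp μ E e (fun v => (Φ v).holds) n a (op s b)
  ne n a a' b b' ha hb h := wp_ne Φ ha (Res.op_ne (Res.dist_refl _ _) hb) h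
  mono n m a a' b h hi hm _ _ := by
    obtain ⟨c, rfl⟩ := hi
    exact wp_op Φ c (wp_mono hm h)

/-- At the unit, which is its own core, both modalities are vacuous and only the wand remains. -/
theorem hoareAt_iff {n : ℕ} {P : Assn (Res Tgt Src G X)} {e : Tgt.Expr}
    {Q : Tgt.Val → Assn (Res Tgt Src G X)} :
    HoareAt μ n P e Q ↔ ∀ m a b, m ≤ n → valid m a → valid m b → P m a b →
      wp μ Set.univ e Q m a b := by
  have h : HoareAt μ n P e Q ↔ wand P (wp μ Set.univ e Q) n unit unit := by
    unfold HoareAt hoare aff always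
    rw [Res.core_unit]
    exact ⟨fun h => h.1.1, fun h => ⟨⟨h, Res.dist_refl _ _⟩, Res.dist_refl _ _⟩⟩
  rw [h]
  unfold wand
  simp only [Res.unit_op]

theorem sep_mono {n m : ℕ} {P Q : Assn (Res Tgt Src G X)} {a b : Res Tgt Src G X} (hm : m ≤ n)
    (hP : ∀ a b, valid m a → valid m b → P n a b → P m a b)
    (hQ : ∀ a b, valid m a → valid m b → Q n a b → Q m a b) (ha : valid m a) (hb : valid m b)
    (h : sep P Q n a b) : sep P Q m a b := by
  obtain ⟨a₁, a₂, b₁, b₂, h₁, h₂, h₃, h₄⟩ := h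
  have h₁ := Res.dist_mono hm h₁
  have h₂ := Res.dist_mono hm h₂
  have ha := Res.valid_ne h₁ ha
  have hb := Res.valid_ne h₂ hb
  exact ⟨a₁, a₂, b₁, b₂, h₁, h₂, hP _ _ (Res.valid_op_left ha) (Res.valid_op_left hb) h₃,
    hQ _ _ (Res.valid_op_right ha) (Res.valid_op_right hb) h₄⟩

end Logic

/-! ## Source triples -/

section Source

variable {Tgt : Lang.{u}} {Src : Lang.{v}} {G : Type w} {X : Type x} [COFE X] [UCMRA G]
  {μ : Model Tgt Src G X} {Q : Tgt.Val → UPred (Res Tgt Src G X)}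

theorem SourceTriple.mono {n m : ℕ} {e : Tgt.Expr} {σ : Tgt.State} {H : SrcExec Src} {i : ℕ}
    {E : Src.Expr} (hm : m ≤ n) (h : SourceTriple μ n e σ Q H i E) :
    SourceTriple μ m e σ Q H i E := by
  -- World satisfaction at index `0` gives no validity, but then `m = 0` and nothing has to be
  -- shown.
  rcases n with _ | n
  · obtain rfl : m = 0 := by omega
    exact h
  obtain ⟨P, h₁, r, s, h₂, h₃, h₄⟩ := h
  refine ⟨P, ?_, r, s, ?_, wsat_mono hm h₃, h₄⟩
  · rw [hoareAt_iff] at h₁ ⊢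
    exact fun k a b hk => h₁ k a b (hk.trans hm)
  · refine sep_mono hm ?_ ?_ (Res.valid_mono hm h₃.valid.1) (Res.valid_mono hm h₃.valid.2) h₂
    · rintro a b - - ⟨k₁, k₂, k₃⟩
      exact ⟨k₁, k₂, Res.dist_mono hm k₃⟩
    · intro a b ha hb hP
      exact P.mono _ _ _ _ _ hP ⟨unit, (Res.op_unit a).symm⟩ hm ha hb

theorem SourceTriple.getElem? {n : ℕ} {e : Tgt.Expr} {σ : Tgt.State} {H : SrcExec Src} {i : ℕ}
    {E : Src.Expr} (h : SourceTriple μ n e σ Q H i E) : H.cur.1[i]? = some E := by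
  obtain ⟨P, -, r, s, ⟨a₁, a₂, b₁, b₂, -, -, ⟨-, h, -⟩, -⟩, -⟩ := h
  exact h

/-- A resource that satisfies the weakest precondition of `e` and controls all source threads gives
rise to a source triple. -/
theorem SourceTriple.of_wp {n : ℕ} {e : Tgt.Expr} {σ : Tgt.State} {H : SrcExec Src} {i : ℕ}
    {E : Src.Expr} {r s : Res Tgt Src G X}
    (hwp : wp μ Set.univ e (fun v => (Q v).holds) n r s) (hw : wsat μ Set.univ σ r s n)
    (hs : ControlsAll H s) (hE : H.cur.1[i]? = some E) : SourceTriple μ n e σ Q H i E := by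
  obtain ⟨hv, hs'⟩ := id hs
  have hi : i < H.cur.1.length := (List.getElem?_eq_some_iff.1 hE).1
  have hun : {i} ∪ (Finset.range H.cur.1.length).erase i = Finset.range H.cur.1.length := by
    rw [← Finset.insert_eq, Finset.insert_erase (Finset.mem_range.2 hi)]
  have hvi : RefValid Src {i} H.cfgs H.idxs := hv.mono (by simpa using hi)
  have hvr : RefValid Src ((Finset.range H.cur.1.length).erase i) H.cfgs H.idxs :=
    hv.mono (Finset.erase_subset _ _)
  -- `si` is what `source` owns exactly; `sr` keeps all other components and the control of the
  -- remaining threads.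
  let si : Res Tgt Src G X :=
    ⟨.empty, .unit, .el ⟨.snapshot, {i}, H.cfgs, H.idxs, hvi⟩, unit⟩
  let sr : Res Tgt Src G X := ⟨s.wld, s.phys, .el ⟨.snapshot, _, H.cfgs, H.idxs, hvr⟩, s.gst⟩
  have hsplit : op si sr = s := by
    ext1
    · exact FMap.empty_mergeWith _
    · exact PhysRes.unit_op _
    · rw [hs']
      refine (RefRes.snapshot_op hvi hvr (hun.symm ▸ hv) (by simp)).trans ?_
      congr 2
    · exact UCMRA.unit_op _
  refine ⟨wpFrame μ Set.univ e Q si, ?_, r, s, ?_, hw, hs⟩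
  · rw [hoareAt_iff]
    rintro m a b - - - ⟨a₁, a₂, b₁, b₂, ha, hb, ⟨_, -, h₁⟩, h₂⟩
    refine wp_ne Q ((Res.dist_equiv m).symm ha) ((Res.dist_equiv m).symm ?_)
      (Res.op_comm a₁ a₂ ▸ wp_op Q a₁ h₂)
    exact (Res.dist_equiv m).trans hb
      (Res.op_ne ((Res.dist_equiv m).symm h₁) (Res.dist_refl _ _))
  · refine ⟨unit, r, si, sr, ?_, ?_, ⟨hvi, hE, Res.dist_refl _ _⟩, ?_⟩
    · rw [Res.unit_op]
      exact Res.dist_refl _ _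
    · rw [hsplit]
      exact Res.dist_refl _ _
    · change wp μ Set.univ e (fun v => (Q v).holds) n r (op si sr)
      rwa [hsplit]

omit [UCMRA G] in
/-- A resource step of a snapshot that controls all threads is a round of all threads. -/
theorem ControlsAll.exists_roundTo {H : SrcExec Src} {s s' : Res Tgt Src G X}
    (h : ControlsAll H s) (hs : s.src.step s'.src) :
    ∃ js H', H.RoundTo (Finset.range H.cur.1.length) js H' ∧ ControlsAll H' s' := by
  obtain ⟨hv, hsrc⟩ := h
  obtain ⟨a, b, C₀, C₁, C₂, spec, own, cs₁, cs₂, ha, hb, -, hbv, hC₀, hrun, hspec, hround, hcfgs,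
    hidxs, htids⟩ := hs
  rw [hsrc, RefRes.el.injEq] at ha
  subst ha
  simp only [SrcExec.cfgs, List.getLast?_append, List.getLast?_singleton, Option.some_or,
    Option.some.injEq] at hC₀
  subst hC₀
  -- A speculated first step would be taken by a thread of the pool, all of which are controlled; so
  -- there is no speculation.
  cases hrun with
  | cons h₁ h₂ => exact absurd (Finset.mem_range.2 h₁.lt_length) (hspec _ (by simp))
  | nil =>
    have hlen := hround.1.length_le
    have hlast : (H.cur :: cs₂).getLast? = some C₂ := hround.1.getLast_eq
    have hne : cs₂ ≠ [] := by
      rintro rfl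
      exact hround.2.1 (List.length_eq_zero_iff.1 hround.1.length_eq)
    have hcs₂ : cs₂.dropLast ++ [C₂] = cs₂ := by
      rw [List.getLast?_cons, List.getLast?_eq_some_getLast hne, Option.getD_some,
        Option.some.injEq] at hlast
      rw [← hlast, List.dropLast_append_getLast]
    -- The old threads and the newly forked ones make up the whole new pool.
    have htids' : b.tids = Finset.range C₂.1.length := by
      rw [htids]
      ext k
      simp only [Finset.mem_union, Finset.mem_range, Finset.mem_Ico]
      omega
    have hc : SrcExec.cfgs ⟨H.cfgs ++ cs₂.dropLast, C₂, H.idxs ++ own⟩ = H.cfgs ++ cs₂ := by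
      rw [SrcExec.cfgs, List.append_assoc, hcs₂]
    have hc' : b.cfgs = H.cfgs ++ cs₂ := by simpa using hcfgs
    have hi' : b.idxs = H.idxs ++ own := by simpa using hidxs
    refine ⟨own, ⟨H.cfgs ++ cs₂.dropLast, C₂, H.idxs ++ own⟩, ⟨cs₂, hround, hc, rfl⟩, ?_⟩
    have hval := b.valid
    rw [htids', hc', hi', ← hc] at hval
    refine ⟨hval, ?_⟩
    rw [hb, RefRes.el.injEq]
    ext1
    · exact hbv
    · exact htids'
    · exact hc'.trans hc.symm
    · exact hi'

/-- Steps of other threads leave thread `i` untouched, and it steps at most once. The states are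
existential because others may have changed the state earlier in the round. -/
theorem SrcExec.RoundTo.exists_getElem? {H H' : SrcExec Src} {K : Finset ℕ} {js : List ℕ}
    (h : H.RoundTo K js H') {i : ℕ} {E : Src.Expr} (hE : H.cur.1[i]? = some E) :
    ∃ E', H'.cur.1[i]? = some E' ∧ (i ∈ js → ∃ S S' f, Src.prim E S E' S' f) ∧
      (i ∉ js → E' = E) := by
  obtain ⟨cs, ⟨hrun, -, hn, -⟩, -⟩ := h
  by_cases hi : i ∈ js
  · obtain ⟨E', S, S', f, hp, hE'⟩ := hrun.exists_prim_of_mem hn hi hE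
    exact ⟨E', hE', fun _ => ⟨S, S', f, hp⟩, fun h => absurd hi h⟩
  · refine ⟨E, ?_, fun h => absurd h hi, fun _ => rfl⟩
    rw [hrun.getElem?_of_notMem hi (List.getElem?_eq_some_iff.1 hE).1, hE]

/-- The weakest precondition at `n + 2` is used with `m = n + 1`, which is positive as its stepping
clause demands. The round obtained may still depend on `n`. -/
theorem SourceTriple.exists_step {n : ℕ} {e e' : Tgt.Expr} {σ σ' : Tgt.State} {H : SrcExec Src}
    {i : ℕ} {E : Src.Expr} (hp : Tgt.prim e σ e' σ' none)
    (h : SourceTriple μ (n + 2) e σ Q H i E) :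
    ∃ js H', H.RoundTo (Finset.range H.cur.1.length) js H' ∧
      ∀ E', H'.cur.1[i]? = some E' → SourceTriple μ (n + 1) e' σ' Q H' i E' := by
  obtain ⟨P, h₁, r, s, h₂, h₃, h₄⟩ := h
  rw [hoareAt_iff] at h₁
  have hwp := h₁ _ r s le_rfl h₃.valid.1 h₃.valid.2 h₂
  rw [wp] at hwp
  have hw : wsat μ (Set.univ ∪ ∅) σ (op r unit) (op s unit) (n + 1 + 1) := by
    rwa [Res.op_unit, Res.op_unit, Set.union_empty]
  obtain ⟨-, k⟩ := (hwp (n + 1) (by omega) unit unit ∅ σ (Set.disjoint_empty _) hw).2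
    (Tgt.val_stuck _ _ _ _ _ hp) (Nat.succ_pos n)
  obtain ⟨r₁, r₂, s₁, s₂, l₁, l₂, l₃, l₄⟩ := k _ _ _ hp
  have hs₂ : s₂ = unit := by
    rcases l₃ with ⟨-, h⟩ | ⟨_, h, -⟩
    · exact Res.eq_unit_of_dist h
    · exact absurd h (by simp)
  subst hs₂
  rw [Res.op_unit, Res.op_unit, Res.op_unit, Set.union_empty] at l₁
  rw [Res.op_unit] at l₄
  obtain ⟨js, H', hr, hc⟩ := h₄.exists_roundTo l₄.1
  exact ⟨js, H', hr, fun E' hE' => .of_wp (wp_op Q r₂ l₂) l₁ hc hE'⟩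

theorem SrcExec.RoundTo.eq_of_eq {H H₁ H₂ : SrcExec Src} {K : Finset ℕ} {js : List ℕ}
    (h₁ : H.RoundTo K js H₁) (h₂ : H.RoundTo K js H₂) (hc : H₁.cfgs = H₂.cfgs) : H₁ = H₂ := by
  obtain ⟨-, -, -, h₁⟩ := h₁
  obtain ⟨-, -, -, h₂⟩ := h₂
  cases H₁
  cases H₂
  obtain ⟨rfl, h⟩ := List.append_inj' hc rfl
  simp at h h₁ h₂
  simp [h, h₁, h₂]

/-- With bounded non-determinism, an execution can be extended by finitely many rounds only. -/
theorem finite_roundTo (hfin : Src.BoundedNondet) (H : SrcExec Src) (K : Finset ℕ) :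
    {p : List ℕ × SrcExec Src | H.RoundTo K p.1 p.2}.Finite := by
  -- A round is determined by its thread indices and the configurations it adds; as no thread
  -- repeats, its length is at most `K.card`.
  refine Set.Finite.of_injOn (f := fun p : List ℕ × SrcExec Src =>
    (p.1, p.2.cfgs.drop H.cfgs.length)) (t := _) ?_ ?_ (hfin.finite_run K.card H.cur)
  · rintro ⟨js, H'⟩ ⟨cs, ⟨hrun, -, hn, hK, -⟩, hc, -⟩
    have hlen : js.length ≤ K.card := by
      rw [← List.toFinset_card_of_nodup hn]
      exact Finset.card_le_card fun j hj => hK j (List.mem_toFinset.1 hj)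
    refine ⟨hlen, H'.cur, ?_⟩
    simpa [hc] using hrun
  · rintro ⟨js, H₁⟩ h₁ ⟨js', H₂⟩ h₂ heq
    simp only [Prod.mk.injEq] at heq
    obtain ⟨rfl, heq⟩ := heq
    obtain ⟨cs₁, -, hc₁, -⟩ := id h₁
    obtain ⟨cs₂, -, hc₂, -⟩ := id h₂
    simp only at hc₁ hc₂ h₁ h₂
    rw [hc₁, hc₂, List.drop_left, List.drop_left] at heq
    exact congrArg _ (SrcExec.RoundTo.eq_of_eq h₁ h₂ (by rw [hc₁, hc₂, heq]))

/-- If an antitone family of predicates is inhabited in a finite set at every index, some element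
satisfies all of them. -/
theorem exists_forall_of_antitone {A : Type u} {S : Set A} (hS : S.Finite) (p : ℕ → A → Prop)
    (hp : ∀ n m a, m ≤ n → p n a → p m a) (h : ∀ n, ∃ a ∈ S, p n a) : ∃ a ∈ S, ∀ n, p n a := by
  by_contra! hcon
  choose! f hf using hcon
  -- `N` bounds the indices at which the finitely many elements fail, so by antitonicity none of
  -- them satisfies `p N`.
  obtain ⟨N, hN⟩ := (hS.image f).bddAbove
  obtain ⟨a, ha, hpa⟩ := h N
  exact hf a ha (hp _ _ _ (hN ⟨a, ha, rfl⟩) hpa)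

theorem exists_forall_sourceTriple (hfin : Src.BoundedNondet) {e e' : Tgt.Expr}
    {σ σ' : Tgt.State} {i : ℕ} {E : Src.Expr} {H : SrcExec Src} (hp : Tgt.prim e σ e' σ' none)
    (h : ∀ n, SourceTriple μ n e σ Q H i E) :
    ∃ (js : List ℕ) (H' : SrcExec Src) (E' : Src.Expr),
      H.RoundTo (Finset.range H.cur.1.length) js H' ∧
      (i ∈ js → ∃ S S' f, Src.prim E S E' S' f) ∧ (i ∉ js → E' = E) ∧
      ∀ n, SourceTriple μ n e' σ' Q H' i E' := by
  obtain ⟨⟨js, H'⟩, hr, hH'⟩ := exists_forall_of_antitone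
    (finite_roundTo hfin H (Finset.range H.cur.1.length))
    -- The choice is made over rounds alone; `E'` is read off from the final configuration
    -- afterwards.
    (fun n p => ∀ E', p.2.cur.1[i]? = some E' → SourceTriple μ n e' σ' Q p.2 i E')
    (fun n m p hm hn E' hE' => (hn E' hE').mono hm)
    (fun n => by
      obtain ⟨js, H', hr, hH'⟩ := (h (n + 2)).exists_step hp
      exact ⟨(js, H'), hr, fun E' hE' => (hH' E' hE').mono (Nat.le_succ n)⟩)
  obtain ⟨E', hE', h₁, h₂⟩ := SrcExec.RoundTo.exists_getElem? hr (h 0).getElem?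
  exact ⟨js, H', E', hr, h₁, h₂, fun n => hH' n E' hE'⟩

theorem SrcExec.RoundTo.of_singleton {H H' : SrcExec Src} {E : Src.Expr} {S : Src.State}
    {js : List ℕ} (hH : H.cur = ([E], S))
    (h : H.RoundTo (Finset.range H.cur.1.length) js H') :
    ∃ E' S' f, Src.prim E S E' S' f ∧ H' = H.snoc 0 (E' :: f.toList, S') := by
  obtain ⟨cs, ⟨hrun, hne, hn, hK, -⟩, hc, hi⟩ := h
  rw [hH] at hK hrun
  -- With one controlled thread, a non-empty round without repetition is a single step of thread
  -- `0`.
  have hjs : js = [0] := by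
    have h0 : ∀ j ∈ js, j = 0 := fun j hj => by simpa using hK j hj
    rcases js with _ | ⟨j, _ | ⟨j', js⟩⟩
    · exact absurd rfl hne
    · rw [h0 j (by simp)]
    · rw [h0 j (by simp), h0 j' (by simp)] at hn
      simp at hn
  subst hjs
  cases hrun with
  | cons h₁ h₂ =>
    have hcur := h₂.getLast_eq
    cases h₂ with
    | nil =>
      obtain ⟨E', S', f, hp, hC⟩ := h₁.of_singleton
      refine ⟨E', S', f, hp, ?_⟩
      obtain ⟨past, cur, idxs⟩ := H'
      obtain ⟨hpast, -⟩ := List.append_inj' hc rfl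
      simp only at hpast hi hC
      subst hpast hi hC
      rfl

end Source

end FairRef

theorem mainTheorem9 {Tgt : Lang.{u}} {Src : Lang.{v}} {G : Type w} {X : Type x}
    [COFE X] [UCMRA G] (μ : Model Tgt Src G X) (hfin : Src.BoundedNondet)
    (Q : Tgt.Val → UPred (Res Tgt Src G X)) :
    -- the source program consists of the single thread `E` in state `S`
    (∀ (e e' : Tgt.Expr) (σ σ' : Tgt.State) (E : Src.Expr) (S : Src.State) (H : SrcExec Src),
      H.cur = ([E], S) →
      Tgt.prim e σ e' σ' none →
      (∀ n, SourceTriple μ n e σ Q H 0 E) →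
      ∃ (E' : Src.Expr) (S' : Src.State) (f : Option Src.Expr),
        Src.prim E S E' S' f ∧
        ∀ n, SourceTriple μ n e' σ' Q (H.snoc 0 (E' :: f.toList, S')) 0 E') ∧
    -- the source program has any number of threads
    (∀ (e e' : Tgt.Expr) (σ σ' : Tgt.State) (i : ℕ) (E : Src.Expr) (H : SrcExec Src),
      Tgt.prim e σ e' σ' none →
      (∀ n, SourceTriple μ n e σ Q H i E) →
      ∃ (js : List ℕ) (H' : SrcExec Src) (E' : Src.Expr),
        H.RoundTo (Finset.range H.cur.1.length) js H' ∧
        (i ∈ js → ∃ S S' f, Src.prim E S E' S' f) ∧ (i ∉ js → E' = E) ∧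
        ∀ n, SourceTriple μ n e' σ' Q H' i E') ∧
    -- iteration
    (∀ (e : ℕ → Tgt.Expr) (σ : ℕ → Tgt.State) (i : ℕ) (E : Src.Expr) (H : SrcExec Src),
      (∀ k, Tgt.prim (e k) (σ k) (e (k + 1)) (σ (k + 1)) none) →
      (∀ n, SourceTriple μ n (e 0) (σ 0) Q H i E) →
      ∃ F, Src.Diverges H.cur F) := by
  have step := fun {e e' σ σ' i E H} =>
    exists_forall_sourceTriple (μ := μ) (Q := Q) hfin (e := e) (e' := e') (σ := σ) (σ' := σ')
      (i := i) (E := E) (H := H)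
  refine ⟨?_, fun e e' σ σ' i E H => step, ?_⟩
  · intro e e' σ σ' E S H hH hp h
    obtain ⟨js, H', E₁, hr, -, -, h'⟩ := step hp h
    obtain ⟨E', S', f, hps, rfl⟩ := hr.of_singleton hH
    refine ⟨E', S', f, hps, ?_⟩
    -- Every source triple, already at index `0`, records which expression its thread is running.
    obtain rfl : E' = E₁ := by simpa [SrcExec.snoc] using (h' 0).getElem?
    exact h'
  · intro e σ i E H hp h
    refine Lang.exists_diverges
      (fun C => ∃ k H' E', H'.cur = C ∧ ∀ n, SourceTriple μ n (e k) (σ k) Q H' i E') ?_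
      ⟨0, H, E, rfl, h⟩
    rintro _ ⟨k, H₁, E₁, rfl, h₁⟩
    obtain ⟨js, H', E', ⟨cs, hr, -⟩, -, -, h'⟩ := step (hp k) h₁
    exact ⟨js, cs, H'.cur, hr.2.1, hr.1, k + 1, H', E', rfl, h'⟩
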